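/- \textbf{Setting.} A trace $\sigma=(\sigma_1,\dots,\sigma_N)$ consists of $N$ requests to objects $1,\dots,M$ with positive sizes; $s_i$ denotes the size of the object $\sigma_i$. Let $\ell_i$ be the time of the next request to $\sigma_i$ after time $i$, and $I$ the set of those $i$ for which such a request exists. For a cache capacity $C$, consider the min-cost flow problem on the nodes $1,\dots,N$ with an inner edge $(i,i+1)$ of capacity $C$ and cost $0$ for each $1\le i<N$, and an outer edge $(i,\ell_i)$ of capacity $s_i$ and cost $1/s_i$ per unit of flow for each $i\in I$. Node $i$ supplies $s_i$ if $i$ is the first request to $\sigma_i$ and demands $s_i$ if $i$ is the last request to $\sigma_i$ (net supply $0$ if it is both or neither). FOO-L is the optimal cost. For an optimal flow with flow $f_j$ on the outer edge $(j,\ell_j)$, put $x_j=1-f_j/s_j$ and $$h_i=\bigl|\{j\in I:\ j\ne i,\ x_j>0,\ j\le i<\ell_j\}\bigr| .$$ Let $N^*$ be the last time $n\le N$ such that the distinct objects requested at times $1,\dots,n$ have total size at most $C$, so that the cache needs to evict after time $N^*$. \textbf{Assumptions.} Let $(\psi_k)_{k\ge1}$ be positive with $\sum_k\psi_k=\infty$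 and put $\rho^M_k=\psi_k/\sum_{j\le M}\psi_j$. Assume that the popularities are not concentrated on finitely many objects: for every fixed $m$, $$\max_{A\subseteq\{1,\dots,M\},\,|A|\le m}\ \sum_{k\in A}\rho^M_k\to0\quad\text{as } M\to\infty .$$ For each $M$, the $N=N_M\ge M\log^2M$ requests are i.i.d. with distribution $\rho^M$, and the sizes of the $M$ objects are i.i.d. from a fixed atomless probability distribution on $(0,b]$, $b<\infty$, independently of the requests. The capacities $C=C_M\ge0$ are scaled such that the expected miss ratio of FOO-L stays constant in the limit: $\mathbb E[\text{FOO-L}]/N_M\to r$ for some $r\in[0,1)$. \textbf{Lemma.} Let $i=i_M$ be any sequence of times with $N_M-i_M\to\infty$. Then at times $i>N^*$ the number of (fractionally) cached objects tends to infinity with probability tending to one: for every $z\in\mathbb N$, $$\mathbb P\bigl(i_M>N^*\ \text{ and some optimal flow has } h_{i_M}\le z\bigr)\longrightarrow 0\qquad\text{as } M\to\infty .$$ -/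

import Mathlib

open MeasureTheory Filter Topology
open scoped ENNReal

namespace FOO

/-! ### Min-cost flow -/

/-- A min-cost flow instance on a directed multigraph with vertex set `V` and edge set `E`. -/
structure MinCostFlow (V E : Type*) where
  src : E → V
  tgt : E → V
  supply : V → ℝ
  capacity : E → ℝ
  cost : E → ℝ

namespace MinCostFlow

variable {V E : Type*} [Fintype E]

open Classical in
/-- A feasible flow respects the edge capacities and, at every node, sends out its supply
on top of what it receives. -/
def IsFeasible (G : MinCostFlow V E) (f : E → ℝ) : Prop :=
  (∀ e, 0 ≤ f e ∧ f e ≤ G.capacity e) ∧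
    ∀ v, (∑ e with G.src e = v, f e) - (∑ e with G.tgt e = v, f e) = G.supply v

/-- The total cost of a flow. -/
def totalCost (G : MinCostFlow V E) (f : E → ℝ) : ℝ := ∑ e, G.cost e * f e

/-- An optimal flow is a feasible flow of minimal cost. -/
def IsOptimal (G : MinCostFlow V E) (f : E → ℝ) : Prop :=
  G.IsFeasible f ∧ ∀ g, G.IsFeasible g → G.totalCost f ≤ G.totalCost g

/-- The optimal cost. -/
noncomputable def optCost (G : MinCostFlow V E) : ℝ := sInf (G.totalCost '' {f | G.IsFeasible f})

end MinCostFlow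

/-! ### Traces and the flow representation of caching

A trace `σ : Fin N → Fin M` has `N` requests to `M` objects, `s : Fin M → ℝ` gives the object
sizes. The element `j : Fin N` stands for the request at time `j + 1 ∈ {1, …, N}`. -/

/-- `l` is the next request after `j` to the object requested at `j`. -/
def IsNext {N M : ℕ} (σ : Fin N → Fin M) (j l : Fin N) : Prop :=
  j < l ∧ σ l = σ j ∧ ∀ k, j < k → k < l → σ k ≠ σ j

/-- The caching intervals of a trace: pairs of consecutive requests to the same object. -/
abbrev Interval {N M : ℕ} (σ : Fin N → Fin M) : Type :=
  {p : Fin N × Fin N // IsNext σ p.1 p.2}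

/-- The inner edges: pairs of consecutive times. -/
abbrev InnerEdge (N : ℕ) : Type := {p : Fin N × Fin N // (p.1 : ℕ) + 1 = p.2}

noncomputable instance {N M : ℕ} (σ : Fin N → Fin M) : Fintype (Interval σ) := Fintype.ofFinite _

/-- The time at which an interval starts. -/
def Interval.start {N M : ℕ} {σ : Fin N → Fin M} (e : Interval σ) : ℕ := e.1.1 + 1

/-- The time of the next request, at which an interval ends. -/
def Interval.finish {N M : ℕ} {σ : Fin N → Fin M} (e : Interval σ) : ℕ := e.1.2 + 1

/-- The size of the object that an interval belongs to. -/
def Interval.size {N M : ℕ} {σ : Fin N → Fin M} (s : Fin M → ℝ) (e : Interval σ) : ℝ :=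
  s (σ e.1.1)

open Classical in
/-- The min-cost flow instance for trace `σ`, object sizes `s` and cache capacity `C`.
The first request to an object supplies its size and the last request demands it (so the two
cancel for an object that is requested only once). -/
noncomputable def flowInstance {N M : ℕ} (σ : Fin N → Fin M) (s : Fin M → ℝ) (C : ℝ) :
    MinCostFlow (Fin N) (InnerEdge N ⊕ Interval σ) where
  src := Sum.elim (fun e => e.1.1) (fun e => e.1.1)
  tgt := Sum.elim (fun e => e.1.2) (fun e => e.1.2)
  supply i := (if ∀ j < i, σ j ≠ σ i then s (σ i) else 0) -
    (if ∀ j > i, σ j ≠ σ i then s (σ i) else 0)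
  capacity := Sum.elim (fun _ => C) (fun e => e.size s)
  cost := Sum.elim (fun _ => 0) (fun e => 1 / e.size s)

/-- FOO-L: the cost of an optimal flow. -/
noncomputable def fooL {N M : ℕ} (σ : Fin N → Fin M) (s : Fin M → ℝ) (C : ℝ) : ℝ :=
  (flowInstance σ s C).optCost

/-- The decision variable of an interval: the fraction of the object that is cached, i.e. whose
flow does not use the outer edge. -/
noncomputable def decision {N M : ℕ} {σ : Fin N → Fin M} (s : Fin M → ℝ)
    (f : InnerEdge N ⊕ Interval σ → ℝ) (e : Interval σ) : ℝ :=
  1 - f (Sum.inr e) / e.size s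

/-- The intervals other than the one starting at time `i` that contain time `i` and are (at least
fractionally) cached under the flow `f`. -/
def cachedSet {N M : ℕ} {σ : Fin N → Fin M} (s : Fin M → ℝ)
    (f : InnerEdge N ⊕ Interval σ → ℝ) (i : ℕ) : Set (Interval σ) :=
  {e | e.start ≠ i ∧ 0 < decision s f e ∧ e.start ≤ i ∧ i < e.finish}

/-- The number of cached objects at time `i`. -/
noncomputable def numCached {N M : ℕ} {σ : Fin N → Fin M} (s : Fin M → ℝ)
    (f : InnerEdge N ⊕ Interval σ → ℝ) (i : ℕ) : ℕ :=
  (cachedSet s f i).ncard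

open Classical in
/-- The total size of the distinct objects requested at times `1, …, n`. -/
noncomputable def requestedSize {N M : ℕ} (σ : Fin N → Fin M) (s : Fin M → ℝ) (n : ℕ) : ℝ :=
  ∑ k with ∃ j : Fin N, (j : ℕ) + 1 ≤ n ∧ σ j = k, s k

/-- The time after which the cache needs to evict: the last time up to which all objects that have
been requested fit into the cache together. -/
noncomputable def evictionTime {N M : ℕ} (σ : Fin N → Fin M) (s : Fin M → ℝ) (C : ℝ) : ℕ :=
  sSup {n | n ≤ N ∧ requestedSize σ s n ≤ C}

/-! ### The random trace -/

/-- The probability that a request goes to object `k` if there are `M` objects. -/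
noncomputable def popularity (ψ : ℕ → ℝ) (M : ℕ) (k : Fin M) : ℝ := ψ k / ∑ j : Fin M, ψ j

/-- The popularity distribution on `M` objects. -/
noncomputable def popularityLaw (ψ : ℕ → ℝ) (M : ℕ) : Measure (Fin M) :=
  ∑ k, ENNReal.ofReal (popularity ψ M k) • Measure.dirac k

/-- The joint law of trace and object sizes: requests are i.i.d. from the popularity distribution,
object sizes are i.i.d. from `S`, and requests and sizes are independent. -/
noncomputable def traceLaw (ψ : ℕ → ℝ) (S : Measure ℝ) (N M : ℕ) :
    Measure ((Fin N → Fin M) × (Fin M → ℝ)) :=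
  (Measure.pi fun _ => popularityLaw ψ M).prod (Measure.pi fun _ => S)

/-- The expected miss ratio of FOO-L. -/
noncomputable def missRatio (ψ : ℕ → ℝ) (S : Measure ℝ) (N M : ℕ) (C : ℝ) : ℝ≥0∞ :=
  (∫⁻ ω, ENNReal.ofReal (fooL ω.1 ω.2 C) ∂(traceLaw ψ S N M)) / N

/-- Diverging popularities: the weights are positive, their sum diverges, and the popularity
distributions do not concentrate on a bounded number of objects as the number of objects grows. -/
structure DivergingPopularity (ψ : ℕ → ℝ) : Prop where
  pos : ∀ k, 0 < ψ k
  diverges : ¬ Summable ψ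
  not_concentrated : ∀ m : ℕ, ∀ ε > 0, ∀ᶠ M : ℕ in atTop, ∀ A : Finset (Fin M),
    A.card ≤ m → ∑ k ∈ A, popularity ψ M k ≤ ε

/-- An atomless distribution of positive object sizes with a finite maximum. -/
structure IsSizeDistribution (S : Measure ℝ) : Prop where
  isProbabilityMeasure : IsProbabilityMeasure S
  no_atoms : ∀ x, S {x} = 0
  pos : ∀ᵐ x ∂S, 0 < x
  bounded : ∃ b : ℝ, ∀ᵐ x ∂S, x ≤ b

end FOO

namespace FOO

/-! ### Caching intervals of a trace -/

section Deterministic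

variable {N M : ℕ} {σ : Fin N → Fin M} {s : Fin M → ℝ} {C : ℝ}

/-! Few cached objects at time `i` would leave the cache far from full throughout a long window
around `i`, and then optimality forces every object requested on both sides of `i` inside the window
to be cached, which is many objects.

Deterministic half. The flow over an inner edge is the cached volume of the intervals crossing it
(`inner_eq_sum`). Each time step starts and ends at most one interval, so with at most `z` cached
objects at time `i`, the cut `c` is crossed by at most `z + 1 + |c - i|` cached intervals, each of
size at most `B`. Hence no inner edge is saturated between `W` steps before and `T` steps after `i`,
provided `(z + 1 + W + T) B < C`. Rerouting flow from a costly outer edge to the free inner path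
shows that an interval inside this window is fully cached, so at most `z + 1` objects are requested
in both halves (`card_requested_around_le`).

Probabilistic half. Take `W` about `C / (2B)` and a large constant `T`. A miss ratio bounded away
from 1 means that many intervals are cached; those that are neither short nor of small objects use
up cache space times time, of which only `N C` is available (`le_fooL_add`). This yields `2δ ≤
hitProb L + C / (ηL)` for all `L`. For fixed `L` the hit probability vanishes because popularities
spread out, so `C → ∞`; for `L` a large multiple of `W` the capacity term is small, so `hitProb W`
stays above some `q > 0`. Of the `T` requests after `i`, about `Tq` or more repeat an object of the
preceding `W` requests, by Chebyshev's inequality, and these are distinct objects with high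
probability. This exceeds `z + 1` once `T` is large. The condition `i > N*` provides the `W` earlier
requests, and `N - i → ∞` the `T` later ones. -/

theorem IsNext.right_unique {j l l' : Fin N} (h : IsNext σ j l) (h' : IsNext σ j l') : l = l' := by
  rcases lt_trichotomy l l' with hl | hl | hl
  · exact absurd h.2.1 (h'.2.2 l h.1 hl)
  · exact hl
  · exact absurd h'.2.1 (h.2.2 l' h'.1 hl)

theorem IsNext.left_unique {j j' l : Fin N} (h : IsNext σ j l) (h' : IsNext σ j' l) : j = j' := by
  rcases lt_trichotomy j j' with hl | hl | hl
  · exact absurd (h'.2.1.symm.trans h.2.1) (h.2.2 j' hl h'.1)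
  · exact hl
  · exact absurd (h.2.1.symm.trans h'.2.1) (h'.2.2 j hl h.1)

theorem Interval.ext_left {e e' : Interval σ} (h : e.1.1 = e'.1.1) : e = e' := by
  obtain ⟨⟨a, b⟩, he⟩ := e
  obtain ⟨⟨a', b'⟩, he'⟩ := e'
  dsimp at h he he'
  subst h
  obtain rfl := he.right_unique he'
  rfl

theorem Interval.ext_right {e e' : Interval σ} (h : e.1.2 = e'.1.2) : e = e' := by
  obtain ⟨⟨a, b⟩, he⟩ := e
  obtain ⟨⟨a', b'⟩, he'⟩ := e'
  dsimp at h he he'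
  subst h
  obtain rfl := he.left_unique he'
  rfl

theorem exists_isNext_of_exists_gt {v : Fin N} (h : ∃ j > v, σ j = σ v) : ∃ l, IsNext σ v l := by
  obtain ⟨l, hl, hmin⟩ := (Set.toFinite {j | v < j ∧ σ j = σ v}).exists_minimal h
  refine ⟨l, hl.1, hl.2, fun k hk hkl hσ => ?_⟩
  exact absurd (hmin (y := k) ⟨hk, hσ⟩ hkl.le) (not_le.2 hkl)

theorem exists_isNext_of_exists_lt {v : Fin N} (h : ∃ j < v, σ j = σ v) : ∃ l, IsNext σ l v := by
  obtain ⟨l, hl, hmax⟩ := (Set.toFinite {j | j < v ∧ σ j = σ v}).exists_maximal h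
  refine ⟨l, hl.1, hl.2.symm, fun k hk hkl hσ => ?_⟩
  exact absurd (hmax (y := k) ⟨hkl, hσ.trans hl.2⟩ hk.le) (not_le.2 hk)

/-- Two requests to the same object before and after a cut enclose an interval that crosses it. -/
theorem exists_isNext_across {i : ℕ} {u v : Fin N} (hu : (u : ℕ) < i) (hv : i ≤ v)
    (h : σ u = σ v) : ∃ a b, IsNext σ a b ∧ u ≤ a ∧ (a : ℕ) < i ∧ i ≤ b ∧ b ≤ v ∧ σ a = σ v := by
  obtain ⟨b, hb, hmin⟩ :=
    (Set.toFinite {j : Fin N | i ≤ j ∧ σ j = σ v}).exists_minimal ⟨v, hv, rfl⟩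
  have hbv : b ≤ v := by
    by_contra hlt
    exact hlt (hmin (y := v) ⟨hv, rfl⟩ (not_le.1 hlt).le)
  have hub : u < b := Fin.lt_def.2 (lt_of_lt_of_le hu hb.1)
  obtain ⟨a, hab⟩ := exists_isNext_of_exists_lt (σ := σ) (v := b) ⟨u, hub, h.trans hb.2.symm⟩
  refine ⟨a, b, hab, ?_, ?_, hb.1, hbv, hab.2.1.symm.trans hb.2⟩
  · by_contra hlt
    exact hab.2.2 u (not_le.1 hlt) hub (h.trans (hb.2.symm.trans hab.2.1))
  · by_contra hlt
    exact absurd (hmin (y := a) ⟨not_lt.1 hlt, hab.2.1.symm.trans hb.2⟩ hab.1.le) (not_le.2 hab.1)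

/-! ### Flow conservation and cuts -/

/-- The amount by which the flow out of the node `v` exceeds the flow into it. -/
noncomputable def divergence (g : InnerEdge N ⊕ Interval σ → ℝ) (v : Fin N) : ℝ :=
  ((∑ p : InnerEdge N, if p.1.1 = v then g (Sum.inl p) else 0) +
      ∑ e : Interval σ, if e.1.1 = v then g (Sum.inr e) else 0) -
    ((∑ p : InnerEdge N, if p.1.2 = v then g (Sum.inl p) else 0) +
      ∑ e : Interval σ, if e.1.2 = v then g (Sum.inr e) else 0)

theorem divergence_add (g h : InnerEdge N ⊕ Interval σ → ℝ) (v : Fin N) :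
    divergence (fun x => g x + h x) v = divergence g v + divergence h v := by
  have key : ∀ (p : Prop) [Decidable p] (x y : ℝ),
      (if p then x + y else 0) = (if p then x else 0) + (if p then y else 0) := by
    intro p _ x y; split_ifs <;> simp
  simp only [divergence, key, Finset.sum_add_distrib]
  ring

theorem divergence_sub (g h : InnerEdge N ⊕ Interval σ → ℝ) (v : Fin N) :
    divergence (fun x => g x - h x) v = divergence g v - divergence h v := by
  rw [eq_sub_iff_add_eq, ← divergence_add]
  simp

theorem isFeasible_iff {f : InnerEdge N ⊕ Interval σ → ℝ} :
    (flowInstance σ s C).IsFeasible f ↔ (∀ p, 0 ≤ f (Sum.inl p) ∧ f (Sum.inl p) ≤ C) ∧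
      (∀ e : Interval σ, 0 ≤ f (Sum.inr e) ∧ f (Sum.inr e) ≤ e.size s) ∧
      ∀ v, divergence f v = (flowInstance σ s C).supply v := by
  unfold MinCostFlow.IsFeasible
  rw [Sum.forall, and_assoc]
  refine and_congr Iff.rfl (and_congr Iff.rfl (forall_congr' fun v => ?_))
  rw [Finset.sum_filter, Finset.sum_filter, Fintype.sum_sum_type, Fintype.sum_sum_type]
  unfold divergence
  congr!

/-- The flow that caches nothing: all outer edges are saturated. -/
noncomputable def bypassFlow (σ : Fin N → Fin M) (s : Fin M → ℝ) : InnerEdge N ⊕ Interval σ → ℝ :=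
  Sum.elim (fun _ => 0) (fun e => e.size s)

open Classical in
theorem sum_size_start_eq (v : Fin N) :
    ∑ e : Interval σ, (if e.1.1 = v then e.size s else 0) =
      s (σ v) - if ∀ j > v, σ j ≠ σ v then s (σ v) else 0 := by
  split_ifs with h
  · rw [sub_self]
    refine Finset.sum_eq_zero fun e _ => if_neg ?_
    rintro rfl
    exact h _ e.2.1 e.2.2.1
  · push Not at h
    obtain ⟨l, hl⟩ := exists_isNext_of_exists_gt h
    rw [Finset.sum_eq_single (⟨(v, l), hl⟩ : Interval σ)]
    · simp [Interval.size]
    · intro e _ he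
      exact if_neg fun h' => he (Interval.ext_left h')
    · simp

open Classical in
theorem sum_size_finish_eq (v : Fin N) :
    ∑ e : Interval σ, (if e.1.2 = v then e.size s else 0) =
      s (σ v) - if ∀ j < v, σ j ≠ σ v then s (σ v) else 0 := by
  split_ifs with h
  · rw [sub_self]
    refine Finset.sum_eq_zero fun e _ => if_neg ?_
    rintro rfl
    exact h _ e.2.1 e.2.2.1.symm
  · push Not at h
    obtain ⟨l, hl⟩ := exists_isNext_of_exists_lt h
    rw [Finset.sum_eq_single (⟨(l, v), hl⟩ : Interval σ)]
    · simp [Interval.size, hl.2.1]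
    · intro e _ he
      exact if_neg fun h' => he (Interval.ext_right h')
    · simp

theorem bypassFlow_isFeasible (hs : ∀ k, 0 ≤ s k) (hC : 0 ≤ C) :
    (flowInstance σ s C).IsFeasible (bypassFlow σ s) := by
  refine isFeasible_iff.2 ⟨fun p => ⟨le_rfl, hC⟩, fun e => ⟨hs _, le_rfl⟩, fun v => ?_⟩
  have h1 := sum_size_start_eq (σ := σ) (s := s) v
  have h2 := sum_size_finish_eq (σ := σ) (s := s) v
  simp only [divergence, bypassFlow, Sum.elim_inl, Sum.elim_inr, ite_self,
    Finset.sum_const_zero, zero_add, h1, h2, flowInstance]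
  ring

/-- The net flow of a circulation out of a set of nodes vanishes. -/
theorem sum_cut_eq_zero {g : InnerEdge N ⊕ Interval σ → ℝ} (hg : ∀ v, divergence g v = 0)
    (p : Fin N → Prop) [DecidablePred p] :
    ((∑ q : InnerEdge N, if p q.1.1 then g (Sum.inl q) else 0) +
        ∑ e : Interval σ, if p e.1.1 then g (Sum.inr e) else 0) -
      ((∑ q : InnerEdge N, if p q.1.2 then g (Sum.inl q) else 0) +
        ∑ e : Interval σ, if p e.1.2 then g (Sum.inr e) else 0) = 0 := by
  have key : ∀ {E : Type} [Fintype E] (t : E → Fin N) (h : E → ℝ),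
      ∑ v with p v, ∑ e, (if t e = v then h e else 0) = ∑ e, if p (t e) then h e else 0 := by
    intro E _ t h
    rw [Finset.sum_comm]
    refine Finset.sum_congr rfl fun e _ => ?_
    rw [Finset.sum_ite_eq]
    simp
  have h0 : ∑ v with p v, divergence g v = 0 := Finset.sum_eq_zero fun v _ => hg v
  simp only [divergence, Finset.sum_sub_distrib, Finset.sum_add_distrib] at h0
  rwa [key (fun q : InnerEdge N => q.1.1), key (fun q : InnerEdge N => q.1.2),
    key (fun q : Interval σ => q.1.1), key (fun q : Interval σ => q.1.2)] at h0

/-- An interval crosses the cut between the times `c` and `c + 1`. -/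
def Interval.Crosses (e : Interval σ) (c : ℕ) : Prop := (e.1.1 : ℕ) < c ∧ c ≤ e.1.2

instance (e : Interval σ) (c : ℕ) : Decidable (e.Crosses c) :=
  inferInstanceAs (Decidable (_ ∧ _))

/-- The flow over an inner edge is what the crossing intervals do not send over outer edges. -/
theorem inner_eq_sum {f : InnerEdge N ⊕ Interval σ → ℝ} (hs : ∀ k, 0 ≤ s k) (hC : 0 ≤ C)
    (hf : (flowInstance σ s C).IsFeasible f) (p : InnerEdge N) :
    f (Sum.inl p) = ∑ e : Interval σ with e.Crosses p.1.2, (e.size s - f (Sum.inr e)) := by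
  -- Both flows have the same supplies, so their difference is a circulation. Across the cut it has
  -- the single inner edge `p`, where `bypassFlow` vanishes.
  have hz := sum_cut_eq_zero (g := fun e => f e - bypassFlow σ s e) (fun v => by
    rw [divergence_sub, (isFeasible_iff.1 hf).2.2 v,
      (isFeasible_iff.1 (bypassFlow_isFeasible (σ := σ) hs hC)).2.2 v, sub_self])
    (fun v => (v : ℕ) < p.1.2)
  simp only [bypassFlow, Sum.elim_inl, Sum.elim_inr, sub_zero] at hz
  rw [add_sub_add_comm, ← Finset.sum_sub_distrib, ← Finset.sum_sub_distrib] at hz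
  have hp := p.2
  rw [Finset.sum_eq_single p] at hz
  · have : ∀ e : Interval σ, ((if (e.1.1 : ℕ) < p.1.2 then f (Sum.inr e) - e.size s else 0) -
        (if (e.1.2 : ℕ) < p.1.2 then f (Sum.inr e) - e.size s else 0)) =
        -(if e.Crosses p.1.2 then (e.size s - f (Sum.inr e)) else 0) := by
      intro e
      have he : (e.1.1 : ℕ) < e.1.2 := e.2.1
      by_cases h1 : (e.1.1 : ℕ) < p.1.2 <;> by_cases h2 : (e.1.2 : ℕ) < p.1.2
      · rw [if_pos h1, if_pos h2, if_neg fun h => not_le.2 h2 h.2]; simp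
      · rw [if_pos h1, if_neg h2, if_pos ⟨h1, not_lt.1 h2⟩]; simp
      · omega
      · rw [if_neg h1, if_neg h2, if_neg fun h => h1 h.1]; simp
    simp only [this, Finset.sum_neg_distrib] at hz
    rw [if_pos (by omega), if_neg (by omega)] at hz
    rw [Finset.sum_filter]
    linarith
  · intro q _ hq
    have h1 := q.2
    have h3 : (q.1.2 : ℕ) ≠ p.1.2 := by
      intro h
      apply hq
      ext <;> omega
    by_cases h : (q.1.2 : ℕ) < p.1.2
    · rw [if_pos (by omega), if_pos h]; simp
    · rw [if_neg (by omega), if_neg h]; simp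
  · simp

theorem size_mul_decision {f : InnerEdge N ⊕ Interval σ → ℝ} (hs : ∀ k, 0 < s k)
    (e : Interval σ) : e.size s * decision s f e = e.size s - f (Sum.inr e) := by
  have : e.size s ≠ 0 := (hs _).ne'
  unfold decision
  field_simp

theorem decision_nonneg {f : InnerEdge N ⊕ Interval σ → ℝ} (hs : ∀ k, 0 < s k)
    (hf : (flowInstance σ s C).IsFeasible f) (e : Interval σ) : 0 ≤ decision s f e := by
  have : 0 < e.size s := hs _
  have h : f (Sum.inr e) ≤ e.size s := (hf.1 (Sum.inr e)).2
  exact sub_nonneg.2 ((div_le_one this).2 h)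

theorem decision_le_one {f : InnerEdge N ⊕ Interval σ → ℝ} (hs : ∀ k, 0 < s k)
    (hf : (flowInstance σ s C).IsFeasible f) (e : Interval σ) : decision s f e ≤ 1 := by
  have : 0 < e.size s := hs _
  have h : 0 ≤ f (Sum.inr e) := (hf.1 (Sum.inr e)).1
  exact sub_le_self _ (div_nonneg h this.le)

theorem totalCost_eq {f : InnerEdge N ⊕ Interval σ → ℝ} :
    (flowInstance σ s C).totalCost f = ∑ e : Interval σ, (1 - decision s f e) := by
  unfold MinCostFlow.totalCost
  rw [Fintype.sum_sum_type]
  simp [flowInstance, decision, div_eq_inv_mul]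

/-! ### Consequences of optimality near a time with few cached objects -/

/-- An optimal flow fully caches every interval that crosses unsaturated cuts only. -/
theorem decision_eq_one_of_unsaturated {f : InnerEdge N ⊕ Interval σ → ℝ} (hs : ∀ k, 0 < s k)
    (hf : (flowInstance σ s C).IsOptimal f) (e : Interval σ)
    (h : ∀ p : InnerEdge N, e.Crosses p.1.2 → f (Sum.inl p) < C) : decision s f e = 1 := by
  by_contra hne
  have hse : 0 < e.size s := hs _
  have hfe : 0 < f (Sum.inr e) := by
    refine lt_of_le_of_ne (hf.1.1 (Sum.inr e)).1 fun h0 => hne ?_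
    simp [decision, ← h0]
  obtain ⟨ε, hε, hεe, hεp⟩ : ∃ ε > 0, ε ≤ f (Sum.inr e) ∧
      ∀ p : InnerEdge N, e.Crosses p.1.2 → f (Sum.inl p) + ε ≤ C := by
    have hall : ∀ᶠ ε in 𝓝[>] (0 : ℝ), ∀ p : InnerEdge N, e.Crosses p.1.2 → f (Sum.inl p) + ε ≤ C := by
      rw [eventually_all]
      intro p
      by_cases hp : e.Crosses p.1.2
      · have : ∀ᶠ ε in 𝓝 (0 : ℝ), ε < C - f (Sum.inl p) := eventually_lt_nhds (by linarith [h p hp])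
        filter_upwards [nhdsWithin_le_nhds this] with ε hε _
        linarith
      · simp [hp]
    have h2 : ∀ᶠ ε in 𝓝[>] (0 : ℝ), ε < f (Sum.inr e) :=
      nhdsWithin_le_nhds (eventually_lt_nhds hfe)
    obtain ⟨ε, h1, h2, h3⟩ := (hall.and (h2.and self_mem_nhdsWithin)).exists
    exact ⟨ε, h3, h2.le, h1⟩
  -- Move `ε` from the outer edge of `e` to the parallel path of inner edges: the divergence is
  -- unchanged and the cost drops by `ε / e.size s`.
  let d : InnerEdge N ⊕ Interval σ → ℝ :=
    Sum.elim (fun p => if e.Crosses p.1.2 then ε else 0) (fun e' => if e' = e then -ε else 0)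
  have hd : (flowInstance σ s C).IsFeasible (fun x => f x + d x) := by
    refine isFeasible_iff.2 ⟨fun p => ?_, fun e' => ?_, fun v => ?_⟩
    · have h1 : 0 ≤ f (Sum.inl p) ∧ f (Sum.inl p) ≤ C := hf.1.1 (Sum.inl p)
      simp only [d, Sum.elim_inl]
      split_ifs with hp
      · exact ⟨by linarith, hεp p hp⟩
      · simpa using h1
    · have h1 : 0 ≤ f (Sum.inr e') ∧ f (Sum.inr e') ≤ e'.size s := hf.1.1 (Sum.inr e')
      simp only [d, Sum.elim_inr]
      split_ifs with hp
      · subst hp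
        exact ⟨by linarith, by linarith⟩
      · simpa using h1
    · rw [divergence_add, (isFeasible_iff.1 hf.1).2.2 v, add_eq_left]
      simp only [divergence, d, Sum.elim_inl, Sum.elim_inr]
      have hab : (e.1.1 : ℕ) < e.1.2 := e.2.1
      have o1 : ∑ x : Interval σ, (if x.1.1 = v then (if x = e then -ε else 0) else 0) =
          if e.1.1 = v then -ε else 0 := by
        rw [Finset.sum_eq_single e] <;> simp +contextual
      have o2 : ∑ x : Interval σ, (if x.1.2 = v then (if x = e then -ε else 0) else 0) =
          if e.1.2 = v then -ε else 0 := by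
        rw [Finset.sum_eq_single e] <;> simp +contextual
      have i1 : ∑ p : InnerEdge N, (if p.1.1 = v then (if e.Crosses p.1.2 then ε else 0) else 0) =
          if e.1.1 ≤ v ∧ v < e.1.2 then ε else 0 := by
        by_cases hv : (v : ℕ) + 1 < N
        · let q : InnerEdge N := ⟨(v, ⟨v + 1, hv⟩), rfl⟩
          rw [Finset.sum_eq_single q]
          · simp only [q, if_true, Interval.Crosses, Fin.le_def, Fin.lt_def]
            exact if_congr (by omega) rfl rfl
          · intro p _ hp
            refine if_neg fun h' => hp ?_
            have := p.2
            ext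
            · simp [q, h']
            · simp [q, ← h', this]
          · simp
        · rw [if_neg, Finset.sum_eq_zero]
          · intro p _
            refine if_neg fun h' => hv ?_
            have := p.2
            have := p.1.2.2
            rw [← h']; omega
          · rintro ⟨-, h'⟩
            have := e.1.2.2
            rw [Fin.lt_def] at h'
            omega
      have i2 : ∑ p : InnerEdge N, (if p.1.2 = v then (if e.Crosses p.1.2 then ε else 0) else 0) =
          if e.1.1 < v ∧ v ≤ e.1.2 then ε else 0 := by
        by_cases hv : 0 < (v : ℕ)
        · let q : InnerEdge N := ⟨(⟨v - 1, by omega⟩, v), by simp; omega⟩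
          rw [Finset.sum_eq_single q]
          · simp only [q, if_true, Interval.Crosses, Fin.le_def, Fin.lt_def]
            exact if_congr Iff.rfl rfl rfl
          · intro p _ hp
            refine if_neg fun h' => hp ?_
            have := p.2
            ext
            · simp [q, ← h', ← this]
            · simp [q, h']
          · simp
        · rw [if_neg, Finset.sum_eq_zero]
          · intro p _
            refine if_neg fun h' => hv ?_
            have := p.2
            rw [← h']; omega
          · rintro ⟨h', -⟩
            rw [Fin.lt_def] at h'
            omega
      rw [o1, o2, i1, i2]
      simp only [Fin.ext_iff, Fin.le_def, Fin.lt_def]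
      split_ifs <;> first | omega | simp
  have hle := hf.2 _ hd
  simp only [MinCostFlow.totalCost, mul_add, Finset.sum_add_distrib] at hle
  have : ∑ x, (flowInstance σ s C).cost x * d x = -(1 / e.size s * ε) := by
    rw [Fintype.sum_sum_type]
    simp [flowInstance, d]
  rw [this] at hle
  have : 0 < 1 / e.size s * ε := by positivity
  linarith

-- A cached interval crossing the cut `c` either crosses the cut `i` too, or starts or ends between
-- the two cuts, and each request starts and ends at most one interval. The summand `1` pays for the
-- interval starting at time `i`, which `cachedSet` leaves out.
open Classical in
theorem card_crosses_cached_le (f : InnerEdge N ⊕ Interval σ → ℝ) {i z : ℕ}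
    (hz : numCached s f i ≤ z) (c : ℕ) :
    (Finset.univ.filter fun e : Interval σ => e.Crosses c ∧ 0 < decision s f e).card ≤
      z + 1 + (c - i) + (i - c) := by
  have hsub : (Finset.univ.filter fun e : Interval σ => e.Crosses c ∧ 0 < decision s f e) ⊆
      (((cachedSet s f i).toFinset ∪ Finset.univ.filter fun e : Interval σ => e.start = i) ∪
        Finset.univ.filter fun e : Interval σ => (e.1.1 : ℕ) ∈ Finset.Ico i c) ∪
        Finset.univ.filter fun e : Interval σ => (e.1.2 : ℕ) ∈ Finset.Ico c i := by
    intro e he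
    obtain ⟨-, ⟨h1, h2⟩, hd⟩ := Finset.mem_filter.1 he
    simp only [Finset.mem_union, Finset.mem_filter, Finset.mem_univ, true_and, Set.mem_toFinset,
      Finset.mem_Ico]
    simp only [cachedSet, Set.mem_ofPred_eq, Interval.start, Interval.finish, hd, true_and]
    omega
  have h1 : (cachedSet s f i).toFinset.card ≤ z := by
    rwa [numCached, Set.ncard_eq_toFinset_card'] at hz
  have h2 : (Finset.univ.filter fun e : Interval σ => e.start = i).card ≤ 1 := by
    refine Finset.card_le_one.2 fun e he e' he' => Interval.ext_left ?_
    have h1 : (e.1.1 : ℕ) + 1 = i := (Finset.mem_filter.1 he).2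
    have h2 : (e'.1.1 : ℕ) + 1 = i := (Finset.mem_filter.1 he').2
    ext; omega
  have h3 : (Finset.univ.filter fun e : Interval σ => (e.1.1 : ℕ) ∈ Finset.Ico i c).card ≤
      c - i := by
    rw [← Nat.card_Ico]
    refine Finset.card_le_card_of_injOn (fun e => (e.1.1 : ℕ)) (fun e he => by simpa using he) ?_
    exact fun e _ e' _ h => Interval.ext_left (Fin.ext h)
  have h4 : (Finset.univ.filter fun e : Interval σ => (e.1.2 : ℕ) ∈ Finset.Ico c i).card ≤
      i - c := by
    rw [← Nat.card_Ico]
    refine Finset.card_le_card_of_injOn (fun e => (e.1.2 : ℕ)) (fun e he => by simpa using he) ?_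
    exact fun e _ e' _ h => Interval.ext_right (Fin.ext h)
  calc _ ≤ _ := Finset.card_le_card hsub
    _ ≤ _ := Finset.card_union_le _ _
    _ ≤ _ := add_le_add ((Finset.card_union_le _ _).trans
      (add_le_add ((Finset.card_union_le _ _).trans (add_le_add h1 h2)) h3)) h4

open Classical in
theorem inner_le_card_mul {f : InnerEdge N ⊕ Interval σ → ℝ} {B : ℝ} (hs : ∀ k, 0 < s k)
    (hB : ∀ k, s k ≤ B) (hC : 0 ≤ C) (hf : (flowInstance σ s C).IsFeasible f) (p : InnerEdge N) :
    f (Sum.inl p) ≤ (Finset.univ.filter fun e : Interval σ =>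
      e.Crosses p.1.2 ∧ 0 < decision s f e).card * B := by
  rw [inner_eq_sum (fun k => (hs k).le) hC hf p, ← nsmul_eq_mul, ← Finset.filter_filter,
    ← Finset.sum_const, Finset.sum_filter (fun e => 0 < decision s f e)]
  refine Finset.sum_le_sum fun e _ => ?_
  rw [← size_mul_decision hs]
  split_ifs with h
  · exact (mul_le_of_le_one_right (hs _).le (decision_le_one hs hf e)).trans (hB _)
  · rw [le_antisymm (not_lt.1 h) (decision_nonneg hs hf e), mul_zero]

open Classical in
/-- If an optimal flow caches few intervals at time `i` compared to the capacity, then only few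
objects are requested both shortly before and shortly after time `i`. -/
theorem card_requested_around_le {f : InnerEdge N ⊕ Interval σ → ℝ} {B : ℝ} {i z W T : ℕ}
    (hs : ∀ k, 0 < s k) (hB : ∀ k, s k ≤ B) (hC : 0 ≤ C)
    (hf : (flowInstance σ s C).IsOptimal f) (hz : numCached s f i ≤ z)
    (hWT : ((z + 1 + W + T : ℕ) : ℝ) * B < C) :
    (Finset.univ.filter fun k : Fin M => ∃ u v : Fin N, σ u = k ∧ σ v = k ∧ i ≤ u + W ∧
      (u : ℕ) < i ∧ i ≤ v ∧ (v : ℕ) < i + T).card ≤ z + 1 := by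
  have hcard := card_crosses_cached_le f hz i
  rw [Nat.sub_self, add_zero, add_zero] at hcard
  refine le_trans ?_ hcard
  refine le_trans (Finset.card_le_card ?_) (Finset.card_image_le (f := fun e => σ e.1.1))
  intro k hk
  simp only [Finset.mem_filter, Finset.mem_univ, true_and] at hk
  obtain ⟨u, v, rfl, huv, hW, hui, hiv, hT⟩ := hk
  obtain ⟨a, b, hab, hua, hai, hib, hbv, hσ⟩ := exists_isNext_across hui hiv huv.symm
  refine Finset.mem_image.2 ⟨⟨(a, b), hab⟩, ?_, hσ.trans huv⟩
  simp only [Finset.mem_filter, Finset.mem_univ, true_and]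
  refine ⟨⟨hai, hib⟩, ?_⟩
  rw [decision_eq_one_of_unsaturated hs hf]
  · exact one_pos
  -- Every cut crossed by the interval lies between `u` and `v`, hence in the window where the inner
  -- flow is below `C`.
  · intro p hp
    have hB0 : 0 ≤ B := (hs (σ u)).le.trans (hB _)
    refine (inner_le_card_mul hs hB hC hf.1 p).trans_lt (lt_of_le_of_lt ?_ hWT)
    refine mul_le_mul_of_nonneg_right (Nat.cast_le.2 ?_) hB0
    refine (card_crosses_cached_le f hz p.1.2).trans ?_
    have h1 : (a : ℕ) < p.1.2 := hp.1
    have h2 : (p.1.2 : ℕ) ≤ b := hp.2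
    rw [Fin.le_def] at hua hbv
    omega

theorem requestedSize_le {B : ℝ} (hB : ∀ k, s k ≤ B) (hB0 : 0 ≤ B) (n : ℕ) :
    requestedSize σ s n ≤ n * B := by
  classical
  unfold requestedSize
  refine (Finset.sum_le_card_nsmul _ _ B fun k _ => hB k).trans ?_
  rw [nsmul_eq_mul]
  refine mul_le_mul_of_nonneg_right (Nat.cast_le.2 ?_) hB0
  have h1 : (Finset.univ.filter fun j : Fin N => (j : ℕ) + 1 ≤ n).card ≤ n := by
    rw [← Finset.card_range n]
    refine Finset.card_le_card_of_injOn (fun j => (j : ℕ)) (fun e he => ?_)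
      (fun _ _ _ _ h => Fin.ext h)
    simp at he ⊢
    omega
  refine le_trans (Finset.card_le_card ?_) ((Finset.card_image_le (f := σ)).trans h1)
  intro k hk
  simpa using hk

/-- The objects of the first `W` requests always fit into the cache, so a time after the first
eviction has `W` requests up to it. -/
theorem le_of_evictionTime_lt {B : ℝ} (hB : ∀ k, s k ≤ B) (hB0 : 0 ≤ B) {W i : ℕ}
    (hW : W * B ≤ C) (hi : evictionTime σ s C < i) (hiN : i ≤ N) : W ≤ i := by
  by_contra! hlt
  refine absurd (le_csSup (s := {n | n ≤ N ∧ requestedSize σ s n ≤ C}) ⟨N, fun n hn => hn.1⟩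
    (a := i) ⟨hiN, ?_⟩) (not_le.2 hi)
  refine (requestedSize_le hB hB0 i).trans (le_trans ?_ hW)
  exact mul_le_mul_of_nonneg_right (Nat.cast_le.2 hlt.le) hB0

/-! ### Lower bound for FOO-L by cache space times time -/

theorem le_card_interval_add (σ : Fin N → Fin M) : N ≤ Fintype.card (Interval σ) + M := by
  classical
  have h1 : (Finset.univ.filter fun j : Fin N => ∃ l > j, σ l = σ j).card ≤
      Fintype.card (Interval σ) := by
    rw [← Finset.card_univ]
    refine le_trans (Finset.card_le_card fun j hj => ?_)
      (Finset.card_image_le (s := Finset.univ) (f := fun e : Interval σ => e.1.1))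
    obtain ⟨l, hl⟩ := exists_isNext_of_exists_gt (Finset.mem_filter.1 hj).2
    exact Finset.mem_image.2 ⟨⟨(j, l), hl⟩, Finset.mem_univ _, rfl⟩
  have h2 : (Finset.univ.filter fun j : Fin N => ¬ ∃ l > j, σ l = σ j).card ≤ M := by
    conv_rhs => rw [← Fintype.card_fin M, ← Finset.card_univ]
    refine Finset.card_le_card_of_injOn σ (fun _ _ => Finset.mem_univ _) ?_
    intro j hj j' hj' h
    simp only [Finset.coe_filter, Finset.mem_univ, true_and, Set.mem_ofPred_eq, not_exists,
      not_and] at hj hj'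
    rcases lt_trichotomy j j' with hlt | heq | hlt
    · exact absurd h.symm (hj _ hlt)
    · exact heq
    · exact absurd h (hj' _ hlt)
  have h3 := Finset.card_filter_add_card_filter_not (s := (Finset.univ : Finset (Fin N)))
    (fun j => ∃ l > j, σ l = σ j)
  rw [Finset.card_univ, Fintype.card_fin] at h3
  omega

theorem le_card_crosses (e : Interval σ) :
    (e.1.2 : ℕ) - e.1.1 ≤ (Finset.univ.filter fun p : InnerEdge N => e.Crosses p.1.2).card := by
  rw [← Fin.card_Ioc]
  refine le_trans (Finset.card_le_card fun j hj => ?_)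
    (Finset.card_image_le (f := fun p : InnerEdge N => p.1.2))
  rw [Finset.mem_Ioc, Fin.lt_def, Fin.le_def] at hj
  exact Finset.mem_image.2 ⟨⟨(⟨j - 1, by omega⟩, j), by simp; omega⟩,
    Finset.mem_filter.2 ⟨Finset.mem_univ _, hj⟩, rfl⟩

/-- Double counting: both orders of summation give the total flow over the inner edges, each of
which carries at most `C`. -/
theorem sum_size_mul_decision_mul_le {f : InnerEdge N ⊕ Interval σ → ℝ} (hs : ∀ k, 0 < s k)
    (hC : 0 ≤ C) (hf : (flowInstance σ s C).IsFeasible f) :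
    ∑ e : Interval σ, e.size s * decision s f e *
      (Finset.univ.filter fun p : InnerEdge N => e.Crosses p.1.2).card ≤ N * C := by
  have h1 : ∑ e : Interval σ, e.size s * decision s f e *
      (Finset.univ.filter fun p : InnerEdge N => e.Crosses p.1.2).card =
      ∑ p : InnerEdge N, f (Sum.inl p) := by
    simp only [inner_eq_sum (fun k => (hs k).le) hC hf, ← size_mul_decision hs,
      Finset.sum_filter]
    rw [Finset.sum_comm]
    refine Finset.sum_congr rfl fun e _ => ?_
    rw [← Finset.sum_filter, Finset.sum_const, nsmul_eq_mul, mul_comm]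
  rw [h1]
  refine (Finset.sum_le_card_nsmul _ _ C fun p _ => (hf.1 (Sum.inl p)).2).trans ?_
  rw [nsmul_eq_mul]
  refine mul_le_mul_of_nonneg_right (Nat.cast_le.2 ?_) hC
  conv_rhs => rw [← Fintype.card_fin N, ← Finset.card_univ]
  refine Finset.card_le_card_of_injOn (fun p => p.1.1) (fun _ _ => Finset.mem_univ _) ?_
  intro p _ q _ h
  have hp := p.2
  have hq := q.2
  dsimp at h
  ext
  · rw [h]
  · rw [← hp, ← hq, h]

open Classical in
/-- A lower bound for FOO-L: cached intervals belong to small objects, are short, or occupy a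
large part of the cache. -/
theorem le_fooL_add (hs : ∀ k, 0 < s k) (hC : 0 ≤ C) {η : ℝ} (hη : 0 < η) {L : ℕ} (hL : 0 < L) :
    (N : ℝ) ≤ fooL σ s C + M + (Finset.univ.filter fun j : Fin N => s (σ j) ≤ η).card +
      (Finset.univ.filter fun j : Fin N => ∃ l, j < l ∧ (l : ℕ) ≤ j + L ∧ σ l = σ j).card +
      N * C / (η * L) := by
  suffices h : (N : ℝ) - M - (Finset.univ.filter fun j : Fin N => s (σ j) ≤ η).card -
      (Finset.univ.filter fun j : Fin N => ∃ l, j < l ∧ (l : ℕ) ≤ j + L ∧ σ l = σ j).card -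
      N * C / (η * L) ≤ fooL σ s C by linarith
  -- The bypass flow rules out the default value of `sInf` on the empty set.
  refine le_csInf ⟨_, _, bypassFlow_isFeasible (fun k => (hs k).le) hC, rfl⟩ ?_
  rintro _ ⟨f, hf, rfl⟩
  change (flowInstance σ s C).IsFeasible f at hf
  rw [totalCost_eq, Finset.sum_sub_distrib, Finset.sum_const, nsmul_eq_mul, mul_one,
    Finset.card_univ]
  have h1 : (N : ℝ) ≤ Fintype.card (Interval σ) + M := by exact_mod_cast le_card_interval_add σ
  have hηL : 0 < η * L := by positivity
  have hpt : ∀ e : Interval σ, decision s f e ≤ (if s (σ e.1.1) ≤ η then 1 else 0) +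
      (if ∃ l, e.1.1 < l ∧ (l : ℕ) ≤ e.1.1 + L ∧ σ l = σ e.1.1 then 1 else 0) +
      e.size s * decision s f e *
        (Finset.univ.filter fun p : InnerEdge N => e.Crosses p.1.2).card / (η * L) := by
    intro e
    have hx := decision_nonneg hs hf e
    have hx1 := decision_le_one hs hf e
    have hse : 0 < e.size s := hs _
    have h0 : 0 ≤ e.size s * decision s f e *
        (Finset.univ.filter fun p : InnerEdge N => e.Crosses p.1.2).card / (η * L) := by
      positivity
    by_cases ha : s (σ e.1.1) ≤ η
    · rw [if_pos ha]
      have : (0 : ℝ) ≤ (if ∃ l, e.1.1 < l ∧ (l : ℕ) ≤ e.1.1 + L ∧ σ l = σ e.1.1 then 1 else 0) := by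
        split_ifs <;> norm_num
      linarith
    by_cases hb : ∃ l, e.1.1 < l ∧ (l : ℕ) ≤ e.1.1 + L ∧ σ l = σ e.1.1
    · rw [if_pos hb, if_neg ha]
      linarith
    rw [if_neg ha, if_neg hb, zero_add, zero_add, le_div_iff₀ hηL]
    have hlen : (L : ℝ) ≤ (Finset.univ.filter fun p : InnerEdge N => e.Crosses p.1.2).card := by
      refine Nat.cast_le.2 (le_trans ?_ (le_card_crosses e))
      by_contra! hlt
      exact hb ⟨e.1.2, e.2.1, by omega, e.2.2.1⟩
    have hsη : η ≤ e.size s := (not_le.1 ha).le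
    calc decision s f e * (η * L) = η * decision s f e * L := by ring
      _ ≤ _ := by gcongr
  have hsum := Finset.sum_le_sum fun e (_ : e ∈ Finset.univ) => hpt e
  rw [Finset.sum_add_distrib, Finset.sum_add_distrib, ← Finset.sum_div] at hsum
  have h2 : N * C / (η * L) ≥ (∑ e : Interval σ, e.size s * decision s f e *
      (Finset.univ.filter fun p : InnerEdge N => e.Crosses p.1.2).card) / (η * L) :=
    div_le_div_of_nonneg_right (sum_size_mul_decision_mul_le hs hC hf) hηL.le
  have hinj : ∀ (q : Fin N → Prop) [DecidablePred q], ∑ e : Interval σ, (if q e.1.1 then (1 : ℝ) else 0) ≤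
      (Finset.univ.filter q).card := by
    intro q _
    rw [Finset.sum_boole]
    refine Nat.cast_le.2 (Finset.card_le_card_of_injOn (fun e => e.1.1) ?_ ?_)
    · intro e he
      simpa using he
    · exact fun e _ e' _ h => Interval.ext_left h
  have h3 := hinj (fun j => s (σ j) ≤ η)
  have h4 := hinj (fun j => ∃ l, j < l ∧ (l : ℕ) ≤ j + L ∧ σ l = σ j)
  linarith

end Deterministic

/-! ### Repetitions among independent samples -/

section Sampling

variable {α ι : Type*} [Fintype α] [MeasurableSpace α] [MeasurableSingletonClass α]
  (μ : Measure α) [IsProbabilityMeasure μ]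

/-- The probability that a sample occurs among `n` further independent samples. -/
noncomputable def hitProb (μ : Measure α) (n : ℕ) : ℝ :=
  ∑ k, μ.real {k} * (1 - (1 - μ.real {k}) ^ n)

theorem sum_real_singleton_eq_one : ∑ k, μ.real {k} = 1 := by
  simp

theorem sum_mul_pow_eq (n : ℕ) :
    ∑ k, μ.real {k} * (1 - μ.real {k}) ^ n = 1 - hitProb μ n := by
  simp only [hitProb, mul_sub, mul_one, Finset.sum_sub_distrib, sum_real_singleton_eq_one]
  ring

theorem hitProb_le_mul {ε : ℝ} (hε : ∀ k, μ.real {k} ≤ ε) (n : ℕ) : hitProb μ n ≤ n * ε := by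
  have h : ∀ k, μ.real {k} * (1 - (1 - μ.real {k}) ^ n) ≤ μ.real {k} * (n * ε) := by
    intro k
    refine mul_le_mul_of_nonneg_left ?_ measureReal_nonneg
    have h1 := one_add_mul_le_pow (a := -μ.real {k}) (by linarith [measureReal_le_one (μ := μ) (s := {k})]) n
    have h2 : n * μ.real {k} ≤ n * ε := mul_le_mul_of_nonneg_left (hε k) n.cast_nonneg
    rw [← sub_eq_add_neg] at h1
    linarith
  refine (Finset.sum_le_sum fun k _ => h k).trans ?_
  rw [← Finset.sum_mul, sum_real_singleton_eq_one, one_mul]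

theorem hitProb_mono {m n : ℕ} (h : m ≤ n) : hitProb μ m ≤ hitProb μ n := by
  refine Finset.sum_le_sum fun k _ => mul_le_mul_of_nonneg_left ?_ measureReal_nonneg
  have := pow_le_pow_of_le_one (a := 1 - μ.real {k}) (by linarith [measureReal_le_one (μ := μ) (s := {k})])
    (by linarith [measureReal_nonneg (μ := μ) (s := {k})]) h
  linarith

/-- A union bound over `K` blocks of `n` samples, in the form of Bernoulli's inequality for `(1 - p)
^ n`. -/
theorem hitProb_mul_le (K n : ℕ) : hitProb μ (K * n) ≤ K * hitProb μ n := by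
  rw [hitProb, hitProb, Finset.mul_sum]
  refine Finset.sum_le_sum fun k _ => ?_
  rw [mul_left_comm]
  refine mul_le_mul_of_nonneg_left ?_ measureReal_nonneg
  have h0 : 0 ≤ (1 - μ.real {k}) ^ n :=
    pow_nonneg (by linarith [measureReal_le_one (μ := μ) (s := {k})]) n
  have h1 := one_add_mul_le_pow (a := (1 - μ.real {k}) ^ n - 1) (by linarith) K
  rw [mul_comm K n, pow_mul]
  rw [add_sub_cancel] at h1
  linarith

theorem sum_sq_le {ε : ℝ} (hε : ∀ k, μ.real {k} ≤ ε) : ∑ k, μ.real {k} ^ 2 ≤ ε := by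
  calc ∑ k, μ.real {k} ^ 2 ≤ ∑ k, μ.real {k} * ε :=
        Finset.sum_le_sum fun k _ => by
          rw [sq]; exact mul_le_mul_of_nonneg_left (hε k) measureReal_nonneg
    _ = ε := by rw [← Finset.sum_mul, sum_real_singleton_eq_one, one_mul]

theorem measureReal_eq_sum_fiber {Ω β : Type*} [MeasurableSpace Ω] [DiscreteMeasurableSpace Ω]
    (P : Measure Ω) [IsFiniteMeasure P] [Fintype β] (f : Ω → β) (E : Set Ω) :
    P.real E = ∑ b, P.real {ω | f ω = b ∧ ω ∈ E} := by
  rw [← measureReal_biUnion_finset]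
  · congr 1
    ext ω
    simp
  · intro b _ b' _ hbb'
    exact Set.disjoint_left.2 fun ω h h' => hbb' (h.1.symm.trans h'.1)
  · exact fun b _ => MeasurableSet.of_discrete

variable [Fintype ι] [DecidableEq ι]

theorem real_pi_fixed_and_mem (J A : Finset ι) (hJA : Disjoint J A) (x : ι → α) (U : Set α) :
    (Measure.pi fun _ : ι => μ).real {σ | (∀ j ∈ J, σ j = x j) ∧ ∀ a ∈ A, σ a ∈ U} =
      (∏ j ∈ J, μ.real {x j}) * μ.real U ^ A.card := by
  have hset : {σ : ι → α | (∀ j ∈ J, σ j = x j) ∧ ∀ a ∈ A, σ a ∈ U} =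
      Set.pi Set.univ fun a => if a ∈ J then {x a} else if a ∈ A then U else Set.univ := by
    ext σ
    simp only [Set.mem_ofPred_eq, Set.mem_pi, Set.mem_univ, true_imp_iff]
    constructor
    · rintro ⟨h1, h2⟩ a
      split_ifs with h3 h4
      · exact h1 a h3
      · exact h2 a h4
      · trivial
    · intro h
      refine ⟨fun j hj => ?_, fun a ha => ?_⟩
      · simpa [hj] using h j
      · simpa [ha, Finset.disjoint_right.1 hJA ha] using h a
  rw [hset, measureReal_def, Measure.pi_pi, ENNReal.toReal_prod]
  have hprod : ∀ a, (μ (if a ∈ J then {x a} else if a ∈ A then U else Set.univ)).toReal =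
      (if a ∈ J then μ.real {x a} else 1) * (if a ∈ A then μ.real U else 1) := by
    intro a
    by_cases h1 : a ∈ J
    · simp [h1, Finset.disjoint_left.1 hJA h1, measureReal_def]
    · by_cases h2 : a ∈ A <;> simp [h1, h2, measureReal_def]
  simp only [hprod, Finset.prod_mul_distrib, Finset.prod_ite_mem, Finset.univ_inter,
    Finset.prod_const]

theorem real_pi_avoid (A : Finset ι) {j : ι} (hj : j ∉ A) :
    (Measure.pi fun _ : ι => μ).real {σ | ∀ a ∈ A, σ a ≠ σ j} = 1 - hitProb μ A.card := by
  rw [measureReal_eq_sum_fiber _ (fun σ => σ j), ← sum_mul_pow_eq]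
  refine Finset.sum_congr rfl fun k _ => ?_
  have h := real_pi_fixed_and_mem μ {j} A (by simpa using hj) (fun _ => k) {k}ᶜ
  rw [Finset.prod_singleton, probReal_compl_eq_one_sub (measurableSet_singleton k)] at h
  rw [← h]
  congr 1
  ext σ
  simp only [Set.mem_ofPred_eq, Finset.mem_singleton, forall_eq, Set.mem_compl_iff,
    Set.mem_singleton_iff]
  refine and_congr_right fun h => ?_
  rw [h]

theorem real_pi_hit (A : Finset ι) {j : ι} (hj : j ∉ A) :
    (Measure.pi fun _ : ι => μ).real {σ | ∃ a ∈ A, σ a = σ j} = hitProb μ A.card := by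
  have h := probReal_compl_eq_one_sub (μ := Measure.pi fun _ : ι => μ)
    (MeasurableSet.of_discrete (s := {σ : ι → α | ∀ a ∈ A, σ a ≠ σ j}))
  rw [real_pi_avoid μ A hj, sub_sub_cancel] at h
  rw [← h]
  congr 1
  ext σ
  simp

theorem real_pi_collision {j j' : ι} (hj : j ≠ j') :
    (Measure.pi fun _ : ι => μ).real {σ | σ j = σ j'} = ∑ k, μ.real {k} ^ 2 := by
  rw [measureReal_eq_sum_fiber _ (fun σ => σ j)]
  refine Finset.sum_congr rfl fun k _ => ?_
  have h := real_pi_fixed_and_mem μ {j, j'} ∅ (by simp) (fun _ => k) Set.univ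
  rw [Finset.prod_pair hj, Finset.card_empty, pow_zero, mul_one, ← sq] at h
  rw [← h]
  congr 1
  ext σ
  simp only [Set.mem_ofPred_eq, Finset.mem_insert, Finset.mem_singleton, forall_eq_or_imp, forall_eq,
    Finset.notMem_empty, Set.mem_univ, implies_true, and_true]
  constructor
  · rintro ⟨h1, h2⟩
    exact ⟨h1, h2.symm.trans h1⟩
  · rintro ⟨h1, h2⟩
    exact ⟨h1, h1.trans h2.symm⟩

/-- Given distinct values `k ≠ l` at `j` and `j'`, the two events are negatively correlated, since
`1 - p - p' ≤ (1 - p) * (1 - p')`. The case `k = l` costs at most the collision probability. -/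
theorem real_pi_avoid_inter_le (A : Finset ι) {j j' : ι} (hj : j ∉ A) (hj' : j' ∉ A)
    (hjj' : j ≠ j') :
    (Measure.pi fun _ : ι => μ).real ({σ | ∀ a ∈ A, σ a ≠ σ j} ∩ {σ | ∀ a ∈ A, σ a ≠ σ j'}) ≤
      (1 - hitProb μ A.card) ^ 2 + ∑ k, μ.real {k} ^ 2 := by
  classical
  rw [measureReal_eq_sum_fiber _ (fun σ => (σ j, σ j')), Fintype.sum_prod_type]
  have hterm : ∀ k l, (Measure.pi fun _ : ι => μ).real {σ | (σ j, σ j') = (k, l) ∧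
      σ ∈ {σ | ∀ a ∈ A, σ a ≠ σ j} ∩ {σ | ∀ a ∈ A, σ a ≠ σ j'}} ≤
      (μ.real {k} * (1 - μ.real {k}) ^ A.card) * (μ.real {l} * (1 - μ.real {l}) ^ A.card) +
        if k = l then μ.real {k} ^ 2 else 0 := by
    intro k l
    have h := real_pi_fixed_and_mem μ {j, j'} A (by simp [hj, hj'])
      (fun a => if a = j then k else l) ({k, l}ᶜ)
    rw [Finset.prod_pair hjj', if_pos rfl, if_neg hjj'.symm] at h
    have heq : {σ : ι → α | (σ j, σ j') = (k, l) ∧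
        σ ∈ {σ | ∀ a ∈ A, σ a ≠ σ j} ∩ {σ | ∀ a ∈ A, σ a ≠ σ j'}} =
        {σ | (∀ i ∈ ({j, j'} : Finset ι), σ i = if i = j then k else l) ∧
          ∀ a ∈ A, σ a ∈ ({k, l} : Set α)ᶜ} := by
      ext σ
      simp only [Set.mem_ofPred_eq, Finset.mem_insert, Finset.mem_singleton, forall_eq_or_imp,
        forall_eq, if_true, if_neg hjj'.symm, Prod.mk.injEq, Set.mem_inter_iff, Set.mem_compl_iff,
        Set.mem_insert_iff, Set.mem_singleton_iff, not_or]
      refine and_congr_right fun h => ?_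
      rw [h.1, h.2]
      exact ⟨fun h a ha => ⟨h.1 a ha, h.2 a ha⟩, fun h => ⟨fun a ha => (h a ha).1, fun a ha => (h a ha).2⟩⟩
    rw [heq, h]
    have hk0 := measureReal_nonneg (μ := μ) (s := {k})
    have hl0 := measureReal_nonneg (μ := μ) (s := {l})
    have hk1 := measureReal_le_one (μ := μ) (s := {k})
    have hl1 := measureReal_le_one (μ := μ) (s := {l})
    by_cases hkl : k = l
    · subst hkl
      rw [if_pos rfl, ← sq]
      have h1 : μ.real ({k, k}ᶜ) ^ A.card ≤ 1 := pow_le_one₀ measureReal_nonneg measureReal_le_one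
      have h2 : 0 ≤ μ.real {k} * (1 - μ.real {k}) ^ A.card :=
        mul_nonneg hk0 (pow_nonneg (by linarith) _)
      have h3 := mul_le_of_le_one_right (sq_nonneg (μ.real {k})) h1
      have h4 := mul_nonneg h2 h2
      linarith
    · rw [if_neg hkl, add_zero, mul_mul_mul_comm, ← mul_pow]
      refine mul_le_mul_of_nonneg_left (pow_le_pow_left₀ measureReal_nonneg ?_ _)
        (mul_nonneg hk0 hl0)
      rw [probReal_compl_eq_one_sub MeasurableSet.of_discrete, Set.insert_eq,
        measureReal_union (by simpa using hkl) (measurableSet_singleton l)]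
      nlinarith
  refine (Finset.sum_le_sum fun k _ => Finset.sum_le_sum fun l _ => hterm k l).trans ?_
  simp only [Finset.sum_add_distrib, ← Finset.mul_sum, ← Finset.sum_mul, sum_mul_pow_eq]
  simp [sq]

/-- Chebyshev's inequality for a count of almost uncorrelated events; the right-hand side bounds the
variance. -/
theorem measureReal_count_ge_mul_sq_le {Ω τ : Type*} [Finite Ω] [MeasurableSpace Ω]
    [DiscreteMeasurableSpace Ω] (P : Measure Ω) [IsProbabilityMeasure P] (T : Finset τ)
    [DecidableEq τ] (E : τ → Set Ω) [∀ ω, DecidablePred fun t => ω ∈ E t] {a v m : ℝ}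
    (hv : 0 ≤ v) (hE : ∀ t ∈ T, P.real (E t) = a)
    (hEE : ∀ t ∈ T, ∀ t' ∈ T, t ≠ t' → P.real (E t ∩ E t') ≤ a ^ 2 + v) (hm : 0 ≤ m) :
    P.real {ω | T.card * a + m ≤ (T.filter fun t => ω ∈ E t).card} * m ^ 2 ≤
      T.card + T.card ^ 2 * v := by
  have hi : ∀ g : Ω → ℝ, Integrable g P := fun g => Integrable.of_finite
  let Y : Ω → ℝ := fun ω => ∑ t ∈ T, (E t).indicator 1 ω
  have hY : ∀ ω, ((T.filter fun t => ω ∈ E t).card : ℝ) = Y ω := by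
    intro ω
    rw [Finset.card_filter, Nat.cast_sum]
    refine Finset.sum_congr rfl fun t _ => ?_
    by_cases h : ω ∈ E t <;> simp [h]
  have hind : ∀ s : Set Ω, ∫ ω, s.indicator (1 : Ω → ℝ) ω ∂P = P.real s := fun s =>
    integral_indicator_one MeasurableSet.of_discrete
  have h1 : ∫ ω, Y ω ∂P = T.card * a := by
    rw [integral_finsetSum _ fun t _ => hi _, Finset.sum_congr rfl fun t ht => (hind _).trans (hE t ht)]
    simp
  have h2 : ∫ ω, Y ω ^ 2 ∂P ≤ T.card + T.card ^ 2 * (a ^ 2 + v) := by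
    have hsq : ∀ ω, Y ω ^ 2 = ∑ t ∈ T, ∑ t' ∈ T, (E t ∩ E t').indicator (1 : Ω → ℝ) ω := by
      intro ω
      simp only [Y, sq, Finset.sum_mul_sum, Set.inter_indicator_one, Pi.mul_apply]
    simp only [hsq]
    rw [integral_finsetSum _ fun t _ => hi _]
    have hb : ∀ t ∈ T, ∀ t' ∈ T, P.real (E t ∩ E t') ≤ (if t = t' then 1 else 0) + (a ^ 2 + v) := by
      intro t ht t' ht'
      by_cases h : t = t'
      · rw [if_pos h]
        exact measureReal_le_one.trans (by nlinarith [sq_nonneg a])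
      · rw [if_neg h, zero_add]
        exact hEE t ht t' ht' h
    calc ∑ t ∈ T, ∫ ω, ∑ t' ∈ T, (E t ∩ E t').indicator (1 : Ω → ℝ) ω ∂P
        = ∑ t ∈ T, ∑ t' ∈ T, P.real (E t ∩ E t') :=
          Finset.sum_congr rfl fun t _ => by
            rw [integral_finsetSum _ fun t _ => hi _]
            exact Finset.sum_congr rfl fun t' _ => hind _
      _ ≤ ∑ t ∈ T, ∑ t' ∈ T, ((if t = t' then 1 else 0) + (a ^ 2 + v)) :=
          Finset.sum_le_sum fun t ht => Finset.sum_le_sum fun t' ht' => hb t ht t' ht'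
      _ = T.card + T.card ^ 2 * (a ^ 2 + v) := by
          simp only [Finset.sum_add_distrib, Finset.sum_ite_eq, Finset.sum_const, nsmul_eq_mul]
          rw [Finset.sum_congr rfl fun t (ht : t ∈ T) => if_pos ht]
          simp
          ring
  have h3 : ∫ ω, (Y ω - T.card * a) ^ 2 ∂P ≤ T.card + T.card ^ 2 * v := by
    have : ∀ ω, (Y ω - T.card * a) ^ 2 = Y ω ^ 2 - 2 * (T.card * a) * Y ω + (T.card * a) ^ 2 := by
      intro ω; ring
    simp only [this]
    rw [integral_add (hi _) (hi _), integral_sub (hi _) (hi _), integral_const_mul, h1,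
      integral_const, probReal_univ, one_smul]
    nlinarith
  refine le_trans ?_ ((mul_meas_ge_le_integral_of_nonneg (Eventually.of_forall fun ω => sq_nonneg _)
    (hi _) (m ^ 2)).trans h3)
  rw [mul_comm]
  refine mul_le_mul_of_nonneg_left (measureReal_mono fun ω hω => ?_) (sq_nonneg m)
  simp only [Set.mem_ofPred_eq, hY] at hω ⊢
  exact pow_le_pow_left₀ hm (by linarith) 2

open Classical in
/-- With high probability, many values are sampled both at the times `A` and at the times `J`. -/
theorem real_pi_card_common_le {ε : ℝ} (hε : ∀ k, μ.real {k} ≤ ε) (A J : Finset ι)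
    (hAJ : Disjoint A J) (z : ℕ) (hz : (z : ℝ) < J.card * hitProb μ A.card) :
    (Measure.pi fun _ : ι => μ).real {σ | (Finset.univ.filter fun k : α =>
        ∃ u ∈ A, ∃ v ∈ J, σ u = k ∧ σ v = k).card ≤ z} ≤
      J.card ^ 2 * ε + (J.card + J.card ^ 2 * ε) / (J.card * hitProb μ A.card - z) ^ 2 := by
  set P := Measure.pi fun _ : ι => μ
  set q := hitProb μ A.card
  have hm : 0 < J.card * q - z := sub_pos.2 hz
  have hsum := sum_sq_le μ hε
  have hε0 : 0 ≤ ε := (Finset.sum_nonneg fun k _ => sq_nonneg _).trans hsum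
  -- Counts the samples in `J` that miss `A`. The deviation is `m = J.card * q - z`, so that the
  -- threshold `J.card * (1 - q) + m` equals `J.card - z`.
  have h1 := measureReal_count_ge_mul_sq_le P J (fun j => {σ : ι → α | ∀ a ∈ A, σ a ≠ σ j})
    (a := 1 - q) (v := ε) hε0 (fun t ht => real_pi_avoid μ A (Finset.disjoint_right.1 hAJ ht))
    (fun t ht t' ht' htt' => (real_pi_avoid_inter_le μ A (Finset.disjoint_right.1 hAJ ht)
      (Finset.disjoint_right.1 hAJ ht') htt').trans (by gcongr)) hm.le
  rw [← le_div_iff₀ (by positivity)] at h1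
  have h2 : P.real (⋃ p ∈ J.offDiag, {σ | σ p.1 = σ p.2}) ≤ J.card ^ 2 * ε := by
    refine (measureReal_biUnion_finset_le _ _).trans ?_
    refine (Finset.sum_le_card_nsmul _ _ ε fun p hp => ?_).trans ?_
    · rw [real_pi_collision μ (Finset.mem_offDiag.1 hp).2.2]
      exact hsum
    · rw [nsmul_eq_mul]
      refine mul_le_mul_of_nonneg_right ?_ hε0
      rw [Finset.offDiag_card, ← sq]
      exact_mod_cast Nat.sub_le _ _
  refine le_trans (measureReal_mono ?_) ((measureReal_union_le _ _).trans (add_le_add h2 h1))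
  intro σ hσ
  -- If the samples in `J` are distinct, hits and common values correspond, so at most `z` samples
  -- in `J` hit `A`; otherwise there is a collision.
  by_cases hinj : Set.InjOn σ J
  · right
    simp only [Set.mem_ofPred_eq] at hσ ⊢
    have h3 : (J.filter fun t => ¬ ∀ a ∈ A, σ a ≠ σ t).card ≤ z := by
      refine le_trans (Finset.card_le_card_of_injOn σ (fun t ht => ?_) (hinj.mono ?_)) hσ
      · have ht' := Finset.mem_filter.1 ht
        obtain ⟨a, ha, hat⟩ : ∃ a ∈ A, σ a = σ t := by simpa using ht'.2
        simpa using ⟨a, ha, t, ht'.1, hat, rfl⟩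
      · intro t ht
        exact (Finset.mem_filter.1 ht).1
    have h4 := Finset.card_filter_add_card_filter_not (s := J) (fun t => ∀ a ∈ A, σ a ≠ σ t)
    have h5 : J.card ≤ (J.filter fun t => ∀ a ∈ A, σ a ≠ σ t).card + z := by omega
    have h6 : (J.card : ℝ) ≤ (J.filter fun t => ∀ a ∈ A, σ a ≠ σ t).card + z :=
      (Nat.cast_le.2 h5).trans_eq (Nat.cast_add _ _)
    suffices h : (J.card : ℝ) * (1 - q) + (J.card * q - z) ≤
        (J.filter fun t => ∀ a ∈ A, σ a ≠ σ t).card by convert h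
    linarith
  · left
    simp only [Set.InjOn, not_forall] at hinj
    obtain ⟨t, ht, t', ht', h, hne⟩ := hinj
    exact Set.mem_biUnion (x := (t, t')) (Finset.mem_offDiag.2 ⟨ht, ht', hne⟩) h

end Sampling

/-! ### The random trace and its expected miss ratio -/

section RandomTrace

variable {ψ : ℕ → ℝ} {S : Measure ℝ} {M : ℕ}

theorem sum_weights_pos (hψ : ∀ k, 0 < ψ k) (hM : 0 < M) : 0 < ∑ j : Fin M, ψ j :=
  Finset.sum_pos (fun j _ => hψ j) ⟨⟨0, hM⟩, Finset.mem_univ _⟩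

theorem popularity_nonneg (hψ : ∀ k, 0 < ψ k) (k : Fin M) : 0 ≤ popularity ψ M k :=
  div_nonneg (hψ k).le (Finset.sum_nonneg fun j _ => (hψ j).le)

theorem popularityLaw_real_singleton (hψ : ∀ k, 0 < ψ k) (k : Fin M) :
    (popularityLaw ψ M).real {k} = popularity ψ M k := by
  rw [measureReal_def, popularityLaw, Measure.finsetSum_apply, Finset.sum_eq_single k]
  · simp [popularity_nonneg hψ k]
  · intro j _ hj
    simp [hj]
  · simp

theorem isProbabilityMeasure_popularityLaw (hψ : ∀ k, 0 < ψ k) (hM : 0 < M) :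
    IsProbabilityMeasure (popularityLaw ψ M) := by
  refine ⟨?_⟩
  rw [popularityLaw, Measure.finsetSum_apply]
  simp only [Measure.smul_apply, measure_univ, smul_eq_mul, mul_one]
  rw [← ENNReal.ofReal_sum_of_nonneg fun k _ => popularity_nonneg hψ k]
  simp only [popularity]
  rw [← Finset.sum_div, div_self (sum_weights_pos hψ hM).ne', ENNReal.ofReal_one]

theorem isProbabilityMeasure_traceLaw [IsProbabilityMeasure S]
    [IsProbabilityMeasure (popularityLaw ψ M)] (N : ℕ) :
    IsProbabilityMeasure (traceLaw ψ S N M) := by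
  unfold traceLaw
  infer_instance

theorem traceLaw_fst_preimage [IsProbabilityMeasure S]
    [IsProbabilityMeasure (popularityLaw ψ M)] {N : ℕ} (A : Set (Fin N → Fin M)) :
    traceLaw ψ S N M {ω | ω.1 ∈ A} = Measure.pi (fun _ => popularityLaw ψ M) A :=
  measurePreserving_fst.measure_preimage (MeasurableSet.of_discrete (s := A)).nullMeasurableSet

theorem ae_traceLaw_sizes [IsProbabilityMeasure S] [IsProbabilityMeasure (popularityLaw ψ M)]
    {p : ℝ → Prop} (hp : ∀ᵐ x ∂S, p x) (N : ℕ) : ∀ᵐ ω ∂traceLaw ψ S N M, ∀ k, p (ω.2 k) := by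
  rw [ae_all_iff]
  intro k
  have h1 : ∀ᵐ s ∂(Measure.pi fun _ : Fin M => S), p (s k) :=
    (measurePreserving_eval (fun _ : Fin M => S) k).quasiMeasurePreserving.ae hp
  exact (measurePreserving_snd (μ := Measure.pi fun _ : Fin N => popularityLaw ψ M)
    (ν := Measure.pi fun _ : Fin M => S)).quasiMeasurePreserving.ae h1

theorem measurableSet_size_le {N : ℕ} (j : Fin N) (η : ℝ) :
    MeasurableSet {ω : (Fin N → Fin M) × (Fin M → ℝ) | ω.2 (ω.1 j) ≤ η} := by
  have h : {ω : (Fin N → Fin M) × (Fin M → ℝ) | ω.2 (ω.1 j) ≤ η} =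
      ⋃ k, {ω | ω.1 j = k} ∩ {ω | ω.2 k ≤ η} := by
    ext ω
    simp
  rw [h]
  refine MeasurableSet.iUnion fun k => MeasurableSet.inter ?_ ?_
  · exact measurable_fst (MeasurableSet.of_discrete (s := {σ : Fin N → Fin M | σ j = k}))
  · exact measurableSet_le ((measurable_pi_apply k).comp measurable_snd) measurable_const

/-- Sizes are independent of requests, so conditionally on the trace the requested size still has
law `S`. -/
theorem traceLaw_size_le [IsProbabilityMeasure S] [IsProbabilityMeasure (popularityLaw ψ M)]
    {N : ℕ} (j : Fin N) (η : ℝ) :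
    (traceLaw ψ S N M).real {ω | ω.2 (ω.1 j) ≤ η} = S.real (Set.Iic η) := by
  rw [measureReal_def, traceLaw, Measure.prod_apply (measurableSet_size_le j η)]
  have h : ∀ σ : Fin N → Fin M, (Measure.pi fun _ : Fin M => S)
      (Prod.mk σ ⁻¹' {ω | ω.2 (ω.1 j) ≤ η}) = S (Set.Iic η) := fun σ =>
    (measurePreserving_eval (fun _ : Fin M => S) (σ j)).measure_preimage
      measurableSet_Iic.nullMeasurableSet
  simp only [h]
  simp [measureReal_def]

theorem card_filter_fin_Ico {N a b : ℕ} (hb : b ≤ N) :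
    (Finset.univ.filter fun u : Fin N => a ≤ u ∧ (u : ℕ) < b).card = b - a := by
  rw [← Nat.card_Ico]
  refine Finset.card_nbij (fun u => (u : ℕ)) ?_ ?_ ?_
  · intro u hu
    simpa using hu
  · exact fun u _ v _ h => Fin.ext h
  · intro n hn
    have hn' := Finset.mem_Ico.1 hn
    exact ⟨⟨n, by omega⟩, by simpa using hn', rfl⟩

theorem card_filter_window_le {N : ℕ} (j : Fin N) (L : ℕ) :
    (Finset.univ.filter fun l : Fin N => j < l ∧ (l : ℕ) ≤ j + L).card ≤ L := by
  have : L = (Finset.Ioc (j : ℕ) (j + L)).card := by simp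
  conv_rhs => rw [this]
  refine Finset.card_le_card_of_injOn (fun l => (l : ℕ)) (fun l hl => ?_)
    (fun u _ v _ h => Fin.ext h)
  simpa using hl

/-- A lower bound for the expected miss ratio of FOO-L. -/
theorem one_le_missRatio_add [IsProbabilityMeasure S] [IsProbabilityMeasure (popularityLaw ψ M)]
    (hS : ∀ᵐ x ∂S, 0 < x) {N : ℕ} (hN : 0 < N) {C η : ℝ} (hC : 0 ≤ C) (hη : 0 < η) {L : ℕ}
    (hL : 0 < L) :
    1 ≤ missRatio ψ S N M C + ENNReal.ofReal
      (M / N + S.real (Set.Iic η) + hitProb (popularityLaw ψ M) L + C / (η * L)) := by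
  classical
  have hprob := isProbabilityMeasure_traceLaw (ψ := ψ) (S := S) (M := M) N
  set P := traceLaw ψ S N M
  let E₁ : Fin N → Set ((Fin N → Fin M) × (Fin M → ℝ)) := fun j => {ω | ω.2 (ω.1 j) ≤ η}
  let E₂ : Fin N → Set ((Fin N → Fin M) × (Fin M → ℝ)) := fun j =>
    {ω | ∃ l, j < l ∧ (l : ℕ) ≤ j + L ∧ ω.1 l = ω.1 j}
  -- The error terms of `le_fooL_add`. Measurability of `g` alone suffices to split the integral of
  -- the sum, so none is needed for `fooL`.
  let g : (Fin N → Fin M) × (Fin M → ℝ) → ℝ := fun ω =>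
    M + N * C / (η * L) + ((∑ j, (E₁ j).indicator 1 ω) + ∑ j, (E₂ j).indicator 1 ω)
  have hE₁ : ∀ j, MeasurableSet (E₁ j) := fun j => measurableSet_size_le j η
  have hE₂ : ∀ j, MeasurableSet (E₂ j) := fun j => measurable_fst (MeasurableSet.of_discrete
    (s := {σ : Fin N → Fin M | ∃ l, j < l ∧ (l : ℕ) ≤ j + L ∧ σ l = σ j}))
  have hi : ∀ E : Set ((Fin N → Fin M) × (Fin M → ℝ)), MeasurableSet E →
      Integrable (E.indicator (1 : (Fin N → Fin M) × (Fin M → ℝ) → ℝ)) P := fun E hE =>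
    (integrable_const (1 : ℝ)).indicator hE
  have hi₁ := integrable_finsetSum Finset.univ fun j (_ : j ∈ Finset.univ) => hi _ (hE₁ j)
  have hi₂ := integrable_finsetSum Finset.univ fun j (_ : j ∈ Finset.univ) => hi _ (hE₂ j)
  have hgi : Integrable g P := (integrable_const _).add (hi₁.add hi₂)
  have hg0 : ∀ ω, 0 ≤ g ω := fun ω => by
    have h : ∀ E : Set ((Fin N → Fin M) × (Fin M → ℝ)), 0 ≤ E.indicator (1 : (Fin N → Fin M) × (Fin M → ℝ) → ℝ) ω :=
      fun E => Set.indicator_nonneg (fun _ _ => zero_le_one) ω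
    have h₁ := Finset.sum_nonneg fun j (_ : j ∈ Finset.univ) => h (E₁ j)
    have h₂ := Finset.sum_nonneg fun j (_ : j ∈ Finset.univ) => h (E₂ j)
    have : 0 ≤ N * C / (η * L) := by positivity
    simp only [g]
    positivity
  have hgm : Measurable g :=
    measurable_const.add ((Finset.measurable_sum _ fun j _ => measurable_one.indicator (hE₁ j)).add
      (Finset.measurable_sum _ fun j _ => measurable_one.indicator (hE₂ j)))
  have hle : ∀ᵐ ω ∂P, (N : ℝ≥0∞) ≤ ENNReal.ofReal (fooL ω.1 ω.2 C) + ENNReal.ofReal (g ω) := by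
    filter_upwards [ae_traceLaw_sizes (ψ := ψ) (M := M) hS N] with ω hω
    have h := le_fooL_add (σ := ω.1) hω hC hη hL
    have hc : ∀ (E : Fin N → Set ((Fin N → Fin M) × (Fin M → ℝ))) (p : Fin N → Prop)
        (_ : DecidablePred p), (∀ j, ω ∈ E j ↔ p j) → ((Finset.univ.filter p).card : ℝ) =
          ∑ j, (E j).indicator (1 : (Fin N → Fin M) × (Fin M → ℝ) → ℝ) ω := by
      intro E p _ hp
      rw [Finset.card_filter, Nat.cast_sum]
      refine Finset.sum_congr rfl fun j _ => ?_
      by_cases h : ω ∈ E j <;> simp [h, ← hp]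
    rw [hc E₁ (fun j => ω.2 (ω.1 j) ≤ η) _ fun _ => Iff.rfl,
      hc E₂ (fun j => ∃ l, j < l ∧ (l : ℕ) ≤ j + L ∧ ω.1 l = ω.1 j) _ fun _ => Iff.rfl] at h
    refine le_trans ?_ ENNReal.ofReal_add_le
    rw [← ENNReal.ofReal_natCast]
    refine ENNReal.ofReal_le_ofReal (h.trans (le_of_eq ?_))
    simp only [g]
    ring
  have hint : ∫ ω, g ω ∂P ≤
      N * (M / N + S.real (Set.Iic η) + hitProb (popularityLaw ψ M) L + C / (η * L)) := by
    have hN' : (N : ℝ) ≠ 0 := by positivity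
    have hadd : ∫ ω, g ω ∂P = _ := integral_add (integrable_const _) (hi₁.add hi₂)
    rw [hadd, integral_add hi₁ hi₂, integral_const, probReal_univ, one_smul,
      integral_finsetSum _ fun j _ => hi _ (hE₁ j), integral_finsetSum _ fun j _ => hi _ (hE₂ j)]
    have h1 : ∀ j, ∫ ω, (E₁ j).indicator 1 ω ∂P = S.real (Set.Iic η) := fun j =>
      (integral_indicator_one (hE₁ j)).trans (traceLaw_size_le j η)
    have h2 : ∀ j, ∫ ω, (E₂ j).indicator 1 ω ∂P ≤ hitProb (popularityLaw ψ M) L := by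
      intro j
      refine (integral_indicator_one (hE₂ j)).trans_le ?_
      have h3 := real_pi_hit (popularityLaw ψ M)
        (Finset.univ.filter fun l : Fin N => j < l ∧ (l : ℕ) ≤ j + L) (j := j) (by simp)
      rw [measureReal_def, ← traceLaw_fst_preimage (S := S), ← measureReal_def] at h3
      -- Near the end of the trace fewer than `L` requests follow.
      refine le_trans (le_of_eq ?_) (hitProb_mono _ (card_filter_window_le j L))
      rw [← h3]
      congr 1
      ext ω
      simp [E₂, and_assoc]
    have h3 := Finset.sum_le_sum fun j (_ : j ∈ Finset.univ) => h2 j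
    simp only [h1]
    refine (add_le_add_right (add_le_add_right h3 _) _).trans (le_of_eq ?_)
    simp only [Finset.sum_const, Finset.card_univ, Fintype.card_fin, nsmul_eq_mul]
    field_simp
    ring
  have hN0 : (N : ℝ≥0∞) ≠ 0 := by exact_mod_cast hN.ne'
  have hNt : (N : ℝ≥0∞) ≠ ∞ := ENNReal.natCast_ne_top N
  have htotal : (N : ℝ≥0∞) ≤ (∫⁻ ω, ENNReal.ofReal (fooL ω.1 ω.2 C) ∂P) + N * ENNReal.ofReal
      (M / N + S.real (Set.Iic η) + hitProb (popularityLaw ψ M) L + C / (η * L)) := by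
    calc (N : ℝ≥0∞) = ∫⁻ _, (N : ℝ≥0∞) ∂P := by simp
      _ ≤ ∫⁻ ω, ENNReal.ofReal (fooL ω.1 ω.2 C) + ENNReal.ofReal (g ω) ∂P := lintegral_mono_ae hle
      _ = (∫⁻ ω, ENNReal.ofReal (fooL ω.1 ω.2 C) ∂P) + ∫⁻ ω, ENNReal.ofReal (g ω) ∂P :=
        lintegral_add_right _ hgm.ennreal_ofReal
      _ ≤ _ := by
        refine add_le_add_right ?_ _
        rw [← ofReal_integral_eq_lintegral_ofReal hgi (Eventually.of_forall hg0),
          ← ENNReal.ofReal_natCast, ← ENNReal.ofReal_mul N.cast_nonneg]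
        exact ENNReal.ofReal_le_ofReal hint
  calc (1 : ℝ≥0∞) = N / N := (ENNReal.div_self hN0 hNt).symm
    _ ≤ _ := ENNReal.div_le_div_right htotal _
    _ = _ := by
      rw [ENNReal.add_div, mul_comm, ENNReal.mul_div_cancel_right hN0 hNt]
      rfl

end RandomTrace

/-! ### Growth of the capacity and the limit -/

section Asymptotics

variable {ψ : ℕ → ℝ} {S : Measure ℝ} {N : ℕ → ℕ} {C : ℕ → ℝ}

theorem eventually_popularityLaw_le (hψ : DivergingPopularity ψ) {ε : ℝ} (hε : 0 < ε) :
    ∀ᶠ M : ℕ in atTop, ∀ k, (popularityLaw ψ M).real {k} ≤ ε := by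
  filter_upwards [hψ.not_concentrated 1 ε hε] with M hM k
  rw [popularityLaw_real_singleton hψ.pos]
  simpa using hM {k} (by simp)

theorem exists_measureReal_Iic_le [IsProbabilityMeasure S] (hS : ∀ᵐ x ∂S, 0 < x) {δ : ℝ}
    (hδ : 0 < δ) : ∃ η > 0, S.real (Set.Iic η) ≤ δ := by
  have h0 : S.real (Set.Iic 0) = 0 := by
    rw [measureReal_eq_zero_iff]
    simpa [ae_iff, Set.Iic] using hS
  have h1 : Tendsto (fun x => S.real (Set.Iic x)) (𝓝[>] 0) (𝓝 (S.real (Set.Iic 0))) := by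
    have := (ProbabilityTheory.cdf S).right_continuous 0
    have h2 := this.tendsto.mono_left (nhdsWithin_mono 0 Set.Ioi_subset_Ici_self)
    rw [← ProbabilityTheory.cdf_eq_real]
    exact h2.congr fun x => ProbabilityTheory.cdf_eq_real S x
  rw [h0] at h1
  obtain ⟨η, hη, hη0⟩ := ((h1.eventually (eventually_le_nhds hδ)).and self_mem_nhdsWithin).exists
  exact ⟨η, hη0, hη⟩

theorem eventually_cast_le_mul (hN : ∀ M : ℕ, (M : ℝ) * Real.log M ^ 2 ≤ N M) {δ : ℝ}
    (hδ : 0 < δ) : ∀ᶠ M : ℕ in atTop, (M : ℝ) ≤ δ * N M := by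
  have hlog : Tendsto (fun M : ℕ => Real.log M ^ 2) atTop atTop :=
    (tendsto_pow_atTop two_ne_zero).comp (Real.tendsto_log_atTop.comp tendsto_natCast_atTop_atTop)
  filter_upwards [hlog.eventually_ge_atTop δ⁻¹] with M hM
  have h1 := (mul_le_mul_of_nonneg_left hM (Nat.cast_nonneg (α := ℝ) M)).trans (hN M)
  calc (M : ℝ) = δ * (M * δ⁻¹) := by field_simp
    _ ≤ _ := mul_le_mul_of_nonneg_left h1 hδ.le

/-- The miss ratio eventually leaves a gap `4δ` below 1, of which `M / N` and the small objects use
at most `δ` each. The threshold for `M` does not depend on `L`, so `L` may later vary with `M`. -/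
theorem eventually_hitProb_add_ge (hψ : DivergingPopularity ψ) (hS : IsSizeDistribution S)
    (hN : ∀ M : ℕ, (M : ℝ) * Real.log M ^ 2 ≤ N M) (hC : ∀ M, 0 ≤ C M) {r : ℝ≥0∞} (hr : r < 1)
    (hmiss : Tendsto (fun M => missRatio ψ S (N M) M (C M)) atTop (𝓝 r)) :
    ∃ δ > 0, ∃ η > 0, ∀ᶠ M : ℕ in atTop, ∀ L : ℕ, 0 < L →
      2 * δ ≤ hitProb (popularityLaw ψ M) L + C M / (η * L) := by
  have := hS.isProbabilityMeasure
  obtain ⟨t, ht0, hrt, ht1⟩ := ENNReal.lt_iff_exists_real_btwn.1 hr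
  have ht1' : t < 1 := by
    rw [← ENNReal.ofReal_one] at ht1
    exact (ENNReal.ofReal_lt_ofReal_iff one_pos).1 ht1
  obtain ⟨δ, hδ, hδt⟩ : ∃ δ > 0, t + 4 * δ = 1 := ⟨(1 - t) / 4, by linarith, by ring⟩
  obtain ⟨η, hη, hSη⟩ := exists_measureReal_Iic_le hS.pos hδ
  refine ⟨δ, hδ, η, hη, ?_⟩
  filter_upwards [hmiss.eventually (eventually_lt_nhds hrt), eventually_cast_le_mul hN hδ,
    eventually_gt_atTop 0] with M h1 h2 hM L hL
  have := isProbabilityMeasure_popularityLaw hψ.pos hM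
  have hN0 : 0 < N M := by
    by_contra h
    rw [Nat.eq_zero_of_not_pos h, Nat.cast_zero, mul_zero] at h2
    exact absurd h2 (not_le.2 (Nat.cast_pos.2 hM))
  have h3 : (M : ℝ) / N M ≤ δ := (div_le_iff₀ (Nat.cast_pos.2 hN0)).2 h2
  have h4 := (one_le_missRatio_add (ψ := ψ) (M := M) hS.pos hN0 (hC M) hη hL).trans
    (add_le_add_left h1.le _)
  by_contra! hlt
  refine absurd h4 (not_le.2 ?_)
  have h5 : M / N M + S.real (Set.Iic η) + hitProb (popularityLaw ψ M) L + C M / (η * L) <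
      4 * δ := by linarith
  calc _ ≤ ENNReal.ofReal t + ENNReal.ofReal (M / N M + S.real (Set.Iic η) +
        hitProb (popularityLaw ψ M) L + C M / (η * L)) := le_rfl
    _ < ENNReal.ofReal t + ENNReal.ofReal (4 * δ) :=
        ENNReal.add_lt_add_left ENNReal.ofReal_ne_top
          ((ENNReal.ofReal_lt_ofReal_iff (by linarith)).2 h5)
    _ = 1 := by rw [← ENNReal.ofReal_add ht0 (by linarith), hδt, ENNReal.ofReal_one]

/-- For fixed `L` the hit probability eventually falls below `δ`, leaving `C M ≥ δηL`; now `L` is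
arbitrary. -/
theorem tendsto_capacity_atTop (hψ : DivergingPopularity ψ) {δ η : ℝ} (hδ : 0 < δ) (hη : 0 < η)
    (h : ∀ᶠ M : ℕ in atTop, ∀ L : ℕ, 0 < L →
      2 * δ ≤ hitProb (popularityLaw ψ M) L + C M / (η * L)) : Tendsto C atTop atTop := by
  refine tendsto_atTop.2 fun R => ?_
  obtain ⟨L, hL⟩ := exists_nat_gt (max 0 (R / (η * δ)))
  have hL0 : (0 : ℝ) < L := (le_max_left _ _).trans_lt hL
  have hLR := (div_lt_iff₀ (by positivity)).1 ((le_max_right _ _).trans_lt hL)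
  filter_upwards [h, eventually_popularityLaw_le hψ (ε := δ / L) (by positivity),
    eventually_gt_atTop 0] with M h1 h2 hM
  have := isProbabilityMeasure_popularityLaw hψ.pos hM
  have h3 := h1 L (Nat.cast_pos.1 hL0)
  have h4 := hitProb_le_mul (popularityLaw ψ M) h2 L
  rw [mul_div_cancel₀ _ hL0.ne'] at h4
  have h5 : δ ≤ C M / (η * L) := by linarith
  rw [le_div_iff₀ (by positivity)] at h5
  nlinarith

/-- The requests in a window of requests that fit into half of the cache contain a later request
with a probability that is bounded away from zero. -/
theorem eventually_hitProb_window_ge (hψ : DivergingPopularity ψ) {δ η B : ℝ} (hδ : 0 < δ)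
    (hη : 0 < η) (hB : 0 < B) (h : ∀ᶠ M : ℕ in atTop, ∀ L : ℕ, 0 < L →
      2 * δ ≤ hitProb (popularityLaw ψ M) L + C M / (η * L)) :
    ∃ q > 0, ∀ᶠ M : ℕ in atTop, q ≤ hitProb (popularityLaw ψ M) ⌊C M / (2 * B)⌋₊ := by
  -- As `C M ≤ 4BW`, this `K` brings the capacity term at `L = K * W` down to `δ`. So `hitProb` at
  -- `K * W` is at least `δ`, and subadditivity gives `δ / K` at `W`.
  obtain ⟨K, hK⟩ := exists_nat_gt (4 * B / (η * δ))
  have hK0 : (0 : ℝ) < K := lt_trans (by positivity) hK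
  rw [div_lt_iff₀ (by positivity)] at hK
  refine ⟨δ / K, by positivity, ?_⟩
  filter_upwards [h, (tendsto_capacity_atTop hψ hδ hη h).eventually_ge_atTop (2 * B),
    eventually_gt_atTop 0] with M h1 h2 hM
  have := isProbabilityMeasure_popularityLaw hψ.pos hM
  set W := ⌊C M / (2 * B)⌋₊
  have hW1 : 1 ≤ W := Nat.le_floor (by rw [Nat.cast_one, le_div_iff₀ (by positivity)]; linarith)
  have hW1' : (1 : ℝ) ≤ W := by exact_mod_cast hW1
  have hW2 : C M ≤ 4 * B * W := by
    have := (div_lt_iff₀ (by positivity)).1 (Nat.lt_floor_add_one (C M / (2 * B)))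
    nlinarith
  have h3 := h1 (K * W) (Nat.mul_pos (Nat.cast_pos.1 hK0) hW1)
  have h4 : C M / (η * (K * W : ℕ)) ≤ δ := by
    rw [Nat.cast_mul, div_le_iff₀ (by positivity)]
    refine hW2.trans ?_
    nlinarith
  have h5 := hitProb_mul_le (popularityLaw ψ M) K W
  rw [div_le_iff₀ hK0]
  linarith

open Classical in
/-- Few cached objects at a time after the first eviction force the trace to request few objects
both shortly before and shortly after this time. -/
theorem traceLaw_numCached_le [IsProbabilityMeasure S] {M : ℕ}
    [IsProbabilityMeasure (popularityLaw ψ M)] (hS : ∀ᵐ x ∂S, 0 < x) {B : ℝ} (hB : 0 < B)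
    (hSB : ∀ᵐ x ∂S, x ≤ B) {n i z W T : ℕ} {c : ℝ} (hc : 0 ≤ c) (hiT : i + T ≤ n)
    (hWc : W * B ≤ c) (hWT : ((z + 1 + W + T : ℕ) : ℝ) * B < c) {ε : ℝ}
    (hε : ∀ k, (popularityLaw ψ M).real {k} ≤ ε)
    (hz : ((z + 1 : ℕ) : ℝ) < T * hitProb (popularityLaw ψ M) W) :
    traceLaw ψ S n M {ω | evictionTime ω.1 ω.2 c < i ∧
      ∃ f, (flowInstance ω.1 ω.2 c).IsOptimal f ∧ numCached ω.2 f i ≤ z} ≤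
      ENNReal.ofReal (T ^ 2 * ε + (T + T ^ 2 * ε) /
        (T * hitProb (popularityLaw ψ M) W - (z + 1 : ℕ)) ^ 2) := by
  by_cases hWi : W ≤ i
  · let A : Finset (Fin n) := Finset.univ.filter fun u => i - W ≤ u ∧ (u : ℕ) < i
    let J : Finset (Fin n) := Finset.univ.filter fun v => i ≤ v ∧ (v : ℕ) < i + T
    have hA : A.card = W := by rw [card_filter_fin_Ico (by omega)]; omega
    have hJ : J.card = T := by rw [card_filter_fin_Ico hiT]; omega
    have hAJ : Disjoint A J := Finset.disjoint_left.2 fun u h1 h2 => by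
      have h1' := (Finset.mem_filter.1 h1).2
      have h2' := (Finset.mem_filter.1 h2).2
      omega
    have h := real_pi_card_common_le (popularityLaw ψ M) hε A J hAJ (z + 1) (by rwa [hA, hJ])
    rw [hA, hJ] at h
    refine le_trans ?_ (ENNReal.ofReal_le_ofReal h)
    rw [ofReal_measureReal, ← traceLaw_fst_preimage (S := S)]
    -- The event on the left is not known to be measurable; monotonicity does not require it.
    refine measure_mono_ae ?_
    filter_upwards [ae_traceLaw_sizes (ψ := ψ) (M := M) hS n,
      ae_traceLaw_sizes (ψ := ψ) (M := M) hSB n] with ω h1 h2 hω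
    obtain ⟨-, f, hf, hfz⟩ := hω
    refine le_trans (Finset.card_le_card fun k hk => ?_)
      (card_requested_around_le h1 h2 hc hf hfz hWT)
    obtain ⟨u, hu, v, hv, huk, hvk⟩ : ∃ u ∈ A, ∃ v ∈ J, ω.1 u = k ∧ ω.1 v = k := by
      simpa only [Finset.mem_filter, Finset.mem_univ, true_and] using hk
    have hu' := (Finset.mem_filter.1 hu).2
    have hv' := (Finset.mem_filter.1 hv).2
    exact Finset.mem_filter.2
      ⟨Finset.mem_univ _, u, v, huk, hvk, by omega, hu'.2, hv'.1, hv'.2⟩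
  -- With fewer than `W` requests up to time `i`, almost surely no eviction has been needed, so the
  -- event is null.
  · refine le_of_eq_of_le ?_ bot_le
    refine measure_eq_zero_iff_ae_notMem.2 ?_
    filter_upwards [ae_traceLaw_sizes (ψ := ψ) (M := M) hSB n] with ω h2 hω
    exact hWi (le_of_evictionTime_lt h2 hB.le hWc hω.1 (by omega))

end Asymptotics

end FOO

theorem mainTheorem8 (ψ : ℕ → ℝ) (hψ : FOO.DivergingPopularity ψ)
    (S : Measure ℝ) (hS : FOO.IsSizeDistribution S)
    (N : ℕ → ℕ) (hN : ∀ M : ℕ, (M : ℝ) * Real.log M ^ 2 ≤ N M)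
    (C : ℕ → ℝ) (hC : ∀ M, 0 ≤ C M)
    (r : ℝ≥0∞) (hr : r < 1)
    (hmiss : Tendsto (fun M => FOO.missRatio ψ S (N M) M (C M)) atTop (𝓝 r))
    (i : ℕ → ℕ) (hi : Tendsto (fun M => (N M : ℤ) - i M) atTop atTop) (z : ℕ) :
    Tendsto (fun M => FOO.traceLaw ψ S (N M) M
      {ω | FOO.evictionTime ω.1 ω.2 (C M) < i M ∧
        ∃ f, (FOO.flowInstance ω.1 ω.2 (C M)).IsOptimal f ∧ FOO.numCached ω.2 f (i M) ≤ z})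
      atTop (𝓝 0) := by
  have := hS.isProbabilityMeasure
  obtain ⟨b, hb⟩ := hS.bounded
  obtain ⟨B, hB, hSB⟩ : ∃ B > 0, ∀ᵐ x ∂S, x ≤ B :=
    ⟨max b 1, by positivity, hb.mono fun x hx => hx.trans (le_max_left _ _)⟩
  obtain ⟨δ, hδ, η, hη, hhit⟩ := FOO.eventually_hitProb_add_ge hψ hS hN hC hr hmiss
  obtain ⟨q, hq, hwin⟩ := FOO.eventually_hitProb_window_ge hψ hδ hη hB hhit
  have hCtop := FOO.tendsto_capacity_atTop hψ hδ hη hhit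
  rw [ENNReal.tendsto_nhds_zero]
  intro ε' hε'
  obtain ⟨ε, hε, hεε'⟩ : ∃ ε : ℝ, 0 < ε ∧ ENNReal.ofReal ε ≤ ε' := by
    rcases eq_or_ne ε' ∞ with rfl | htop
    · exact ⟨1, one_pos, le_top⟩
    · exact ⟨ε'.toReal, ENNReal.toReal_pos hε'.ne' htop, (ENNReal.ofReal_toReal htop).le⟩
  -- The first bound makes `z + 1` less than half of `Tq`; the second makes the variance term `4 /
  -- (T * q ^ 2)` at most `ε / 2`.
  obtain ⟨T, hT⟩ := exists_nat_gt (max (2 * ((z + 1 : ℕ) : ℝ) / q) (8 / (ε * q ^ 2)))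
  have hT1 := (le_max_left _ _).trans_lt hT
  have hT2 := (le_max_right _ _).trans_lt hT
  have hT0 : (0 : ℝ) < T := lt_of_le_of_lt (by positivity) hT1
  rw [div_lt_iff₀ hq] at hT1
  rw [div_lt_iff₀ (by positivity)] at hT2
  -- A bound on the popularities, chosen after `T`, for which all collision terms together take the
  -- other `ε / 2`.
  obtain ⟨e, he, heε⟩ : ∃ e : ℝ, 0 < e ∧ (T ^ 2 + 4 / q ^ 2) * e = ε / 2 :=
    ⟨ε / 2 / (T ^ 2 + 4 / q ^ 2), by positivity, by field_simp⟩
  filter_upwards [hwin, FOO.eventually_popularityLaw_le hψ he, hi.eventually_ge_atTop (T : ℤ),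
    -- `W` objects fill at most half of the cache; the other half has room for `z + 1 + T` more.
    hCtop.eventually_gt_atTop (2 * ((z + 1 + T : ℕ) * B)), eventually_gt_atTop 0]
    with M h1 h2 h3 h4 hM
  have := FOO.isProbabilityMeasure_popularityLaw hψ.pos hM
  set W := ⌊C M / (2 * B)⌋₊
  have hW : W * B ≤ C M / 2 := by
    have := Nat.floor_le (a := C M / (2 * B)) (div_nonneg (hC M) (by positivity))
    calc (W : ℝ) * B ≤ C M / (2 * B) * B := mul_le_mul_of_nonneg_right this hB.le
      _ = C M / 2 := by field_simp
  have hTq : T * q ≤ T * FOO.hitProb (FOO.popularityLaw ψ M) W :=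
    mul_le_mul_of_nonneg_left h1 hT0.le
  have hz0 : (0 : ℝ) < ((z + 1 : ℕ) : ℝ) := by positivity
  refine (FOO.traceLaw_numCached_le hS.pos hB hSB (hC M) (W := W) (T := T) (by omega)
    (hW.trans (half_le_self (hC M))) ?_ h2 (by linarith)).trans
    ((ENNReal.ofReal_le_ofReal ?_).trans hεε')
  · push_cast at h4 ⊢
    linarith
  · have hden : T * q / 2 ≤ T * FOO.hitProb (FOO.popularityLaw ψ M) W - (z + 1 : ℕ) := by linarith
    have hfrac : (T + T ^ 2 * e) / (T * FOO.hitProb (FOO.popularityLaw ψ M) W - (z + 1 : ℕ)) ^ 2 ≤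
        (T + T ^ 2 * e) / (T * q / 2) ^ 2 := by
      gcongr
    have heq : (T + T ^ 2 * e) / (T * q / 2) ^ 2 = 4 / (T * q ^ 2) + 4 / q ^ 2 * e := by
      field_simp
      ring
    have hTε : 4 / (T * q ^ 2) ≤ ε / 2 := by
      rw [div_le_iff₀ (by positivity)]
      linarith
    linarith
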